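/- Let $p$ be a prime, $K=\overline{\mathbb F}_p$. For $x\in\mathbb F_p\subset K$ let $[x]$ denote the least non-negative integer with residue $x$ modulo $p$; for $x\in K\setminus\mathbb F_p$ the symbol $[x]$ is undefined. Let $Y(\mathfrak{gl}_2)$ be the Yangian over $K$: the associative algebra with generators $t_{ij}^{(r)}$ ($i,j\in\{1,2\}$, $r\ge 1$) and relations $(u-v)[t_{ij}(u),t_{kl}(v)]=t_{kj}(u)t_{il}(v)-t_{kj}(v)t_{il}(u)$, where $t_{ij}(u)=\delta_{ij}+\sum_{r\ge1}t_{ij}^{(r)}u^{-r}$. It acts on tensor products through the comultiplication $\Delta(t_{ij}(u))=\sum_a t_{ia}(u)\otimes t_{aj}(u)$, and on every $\mathfrak{gl}_2$-module through the evaluation homomorphism $t_{ij}(u)\mapsto\delta_{ij}+E_{ij}u^{-1}$. For $\alpha,\beta\in K$ let $M(\alpha,\beta,p)$ be the Verma module of $\mathfrak{gl}_2$ over $K$ with highest weight vector $v$ ($E_{12}v=0$, $E_{11}v=\alpha v$, $E_{22}v=\beta v$; basis $f^kv$, $k\ge0$, $f=E_{21}$), and let $L(\alpha,\beta,p)$ be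 its irreducible quotient by the largest submodule contained in $\bigoplus_{k\ge1}Kf^kv$. (It has basis $f^kv$, $0\le k\le l$, with $l=[\alpha-\beta]$ if $\alpha-\beta\in\mathbb F_p$ and $l=p-1$ otherwise.) Let $\alpha_1,\dots,\alpha_k$ and $\beta_1,\dots,\beta_k$ be two sequences of elements of $K$. Then each of the two sequences can be renumbered so that the following holds for every $i=1,\dots,k$: (i) if $\alpha_i-\beta_i\in\mathbb F_p$, then $[\alpha_i-\beta_i]\le[\alpha_j-\beta_l]$ for all $j,l\ge i$ with $\alpha_j-\beta_l\in\mathbb F_p$; (ii) if $\alpha_i-\beta_i\notin\mathbb F_p$, then $\alpha_j-\beta_l\notin\mathbb F_p$ for all $j,l\ge i$. For every such renumbering the tensor product $$L(\alpha_1,\beta_1,p)\otimes\cdots\otimes L(\alpha_k,\beta_k,p)$$ of evaluation modules is an irreducible $Y(\mathfrak{gl}_2)$-module. -/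

import Mathlib

open scoped TensorProduct

attribute [local instance 100] LieRing.ofAssociativeRing

noncomputable section

universe u

/-! ## Representations of an associative algebra -/

/-- A representation of an associative `K`-algebra `A`: a vector space with an action of `A`. -/
structure AlgRep (K : Type u) [Field K] (A : Type*) [Ring A] [Algebra K A] where
  carrier : Type u
  [addCommGroup : AddCommGroup carrier]
  [module : Module K carrier]
  ρ : A →ₐ[K] Module.End K carrier

namespace AlgRep

attribute [instance] AlgRep.addCommGroup AlgRep.module

variable {K : Type u} [Field K] {A : Type*} [Ring A] [Algebra K A]
  {B : Type*} [Ring B] [Algebra K B]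

/-- A subspace is a subrepresentation if it is stable under the action of the algebra. -/
def IsSubrep (M : AlgRep K A) (W : Submodule K M.carrier) : Prop :=
  ∀ a : A, ∀ w ∈ W, M.ρ a w ∈ W

/-- A representation is irreducible if it is nonzero and has exactly the two trivial
subrepresentations. -/
def IsIrreducible (M : AlgRep K A) : Prop :=
  Nontrivial M.carrier ∧ ∀ W : Submodule K M.carrier, M.IsSubrep W → W = ⊥ ∨ W = ⊤

/-- Pull-back of a representation of `A` along an algebra homomorphism `B → A`. -/
def pullback (f : B →ₐ[K] A) (M : AlgRep K A) : AlgRep K B where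
  carrier := M.carrier
  ρ := M.ρ.comp f

/-- The quotient of a representation by a subrepresentation. -/
def quotient (M : AlgRep K A) (W : Submodule K M.carrier) (hW : M.IsSubrep W) : AlgRep K A where
  carrier := M.carrier ⧸ W
  ρ :=
    { toFun := fun a => W.mapQ W (M.ρ a) (hW a)
      map_one' := by ext x; simp
      map_mul' := fun a b => by ext x; simp
      map_zero' := by ext x; simp
      map_add' := fun a b => by ext x; simp
      commutes' := fun c => by ext x; simp [Algebra.algebraMap_eq_smul_one] }

/-- The largest subrepresentation contained in the kernel of a linear form `ε`. -/
def largestSubrepInKer (M : AlgRep K A) (ε : M.carrier →ₗ[K] K) : Submodule K M.carrier where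
  carrier := {x | ∀ a : A, ε (M.ρ a x) = 0}
  zero_mem' := fun a => by simp
  add_mem' := fun {x y} hx hy a => by
    rw [map_add, map_add, hx a, hy a, add_zero]
  smul_mem' := fun c x hx a => by
    rw [map_smul, map_smul, hx a, smul_zero]

theorem isSubrep_largestSubrepInKer (M : AlgRep K A) (ε : M.carrier →ₗ[K] K) :
    M.IsSubrep (M.largestSubrepInKer ε) := fun a x hx b => by
  have h := hx (b * a)
  rwa [map_mul] at h

end AlgRep

/-! ## The Yangian of `gl_n` -/

section Yangian

variable {K : Type u} [Field K] {ι : Type} [DecidableEq ι]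

/-- A family `t i j r` (`r ≥ 0`) of elements of a ring, viewed as the coefficients of
`t_ij(u) = ∑ r, t i j r * u ^ (-r)`, satisfies the defining relations of the Yangian:
`t i j 0 = δ_ij`, and the ternary relation `R(u - v) T₁(u) T₂(v) = T₂(v) T₁(u) R(u - v)` with
`R(u) = 1 - P / u`, that is,
`(u - v) [t_ij(u), t_kl(v)] = t_kj(u) t_il(v) - t_kj(v) t_il(u)`;
below, the coefficients of `u ^ (-r) * v ^ (-s)` on both sides are compared. -/
structure IsRTT {A : Type*} [Ring A] (t : ι → ι → ℕ → A) : Prop where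
  zero : ∀ i j, t i j 0 = if i = j then 1 else 0
  rel : ∀ i j k l r s,
    (t i j (r + 1) * t k l s - t k l s * t i j (r + 1))
      - (t i j r * t k l (s + 1) - t k l (s + 1) * t i j r)
      = t k j r * t i l s - t k j s * t i l r

/-- Generators of the free algebra, extended by `t i j 0 = δ_ij`. -/
def freeGen (K : Type u) [Field K] {ι : Type} [DecidableEq ι] (i j : ι) :
    ℕ → FreeAlgebra K (ι × ι × ℕ)
  | 0 => if i = j then 1 else 0
  | r + 1 => FreeAlgebra.ι K (i, j, r)

/-- The defining relations of the Yangian, inside the free algebra. -/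
inductive YangianRel (K : Type u) [Field K] (ι : Type) [DecidableEq ι] :
    FreeAlgebra K (ι × ι × ℕ) → FreeAlgebra K (ι × ι × ℕ) → Prop
  | rtt (i j k l : ι) (r s : ℕ) :
    YangianRel K ι
      ((freeGen K i j (r + 1) * freeGen K k l s - freeGen K k l s * freeGen K i j (r + 1))
        - (freeGen K i j r * freeGen K k l (s + 1) - freeGen K k l (s + 1) * freeGen K i j r))
      (freeGen K k j r * freeGen K i l s - freeGen K k j s * freeGen K i l r)

/-- The Yangian `Y(gl_n)` over `K`, where `n` is the cardinality of `ι`. -/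
def Yangian (K : Type u) [Field K] (ι : Type) [DecidableEq ι] : Type u :=
  RingQuot (YangianRel K ι)

namespace Yangian

instance instRing : Ring (Yangian K ι) :=
  inferInstanceAs (Ring (RingQuot (YangianRel K ι)))

instance instAlgebra : Algebra K (Yangian K ι) :=
  inferInstanceAs (Algebra K (RingQuot (YangianRel K ι)))

/-- The quotient map from the free algebra. -/
def mk (K : Type u) [Field K] (ι : Type) [DecidableEq ι] :
    FreeAlgebra K (ι × ι × ℕ) →ₐ[K] Yangian K ι :=
  RingQuot.mkAlgHom K (YangianRel K ι)

theorem mk_rel {x y : FreeAlgebra K (ι × ι × ℕ)} (h : YangianRel K ι x y) :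
    mk K ι x = mk K ι y :=
  RingQuot.mkAlgHom_rel K h

/-- The element `t_ij^(r)` of the Yangian, with `t_ij^(0) = δ_ij`. -/
def t (K : Type u) [Field K] {ι : Type} [DecidableEq ι] (i j : ι) (r : ℕ) : Yangian K ι :=
  mk K ι (freeGen K i j r)

theorem isRTT_t (K : Type u) [Field K] (ι : Type) [DecidableEq ι] :
    IsRTT (t K : ι → ι → ℕ → Yangian K ι) where
  zero i j := by
    unfold t freeGen
    split_ifs <;> simp
  rel i j k l r s := by
    have h := mk_rel (YangianRel.rtt (K := K) (ι := ι) i j k l r s)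
    simp only [map_sub, map_mul] at h
    exact h

/-- The universal property of the Yangian. -/
def lift {A : Type*} [Ring A] [Algebra K A] (T : ι → ι → ℕ → A) (hT : IsRTT T) :
    Yangian K ι →ₐ[K] A :=
  RingQuot.liftAlgHom K ⟨FreeAlgebra.lift K (fun x => T x.1 x.2.1 (x.2.2 + 1)), by
    have key : ∀ i j r, FreeAlgebra.lift K (fun x : ι × ι × ℕ => T x.1 x.2.1 (x.2.2 + 1))
        (freeGen K i j r) = T i j r := by
      intro i j r
      cases r with
      | zero => rw [hT.zero]; unfold freeGen; split_ifs <;> simp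
      | succ r => simp [freeGen]
    rintro _ _ ⟨i, j, k, l, r, s⟩
    simp only [map_sub, map_mul, key]
    exact hT.rel i j k l r s⟩

theorem lift_t {A : Type*} [Ring A] [Algebra K A] (T : ι → ι → ℕ → A) (hT : IsRTT T)
    (i j : ι) (r : ℕ) : lift (K := K) T hT (t K i j r) = T i j r := by
  unfold lift t
  refine (RingQuot.liftAlgHom_mkAlgHom_apply K _ _ _).trans ?_
  cases r with
  | zero => rw [hT.zero]; unfold freeGen; split_ifs <;> simp
  | succ r => simp [freeGen]

end Yangian

/-! ### The comultiplication -/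

/-- The series `∑ r, a r * x ^ r` in the ring of series in `y` (inner) and `x` (outer). -/
def outerSeries {A : Type*} [Ring A] (a : ℕ → A) : PowerSeries (PowerSeries A) :=
  PowerSeries.mk fun r => PowerSeries.C (a r)

/-- The series `∑ s, a s * y ^ s` in the ring of series in `y` (inner) and `x` (outer). -/
def innerSeries {A : Type*} [Ring A] (a : ℕ → A) : PowerSeries (PowerSeries A) :=
  PowerSeries.C (PowerSeries.mk a)

section Series

variable {A : Type*} [Ring A]

theorem coeff_outer_mul_inner (a b : ℕ → A) (r s : ℕ) :
    PowerSeries.coeff s (PowerSeries.coeff r (outerSeries a * innerSeries b)) = a r * b s := by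
  simp [outerSeries, innerSeries, PowerSeries.coeff_mul_C]

theorem coeff_inner_mul_outer (a b : ℕ → A) (r s : ℕ) :
    PowerSeries.coeff s (PowerSeries.coeff r (innerSeries b * outerSeries a)) = b s * a r := by
  simp [outerSeries, innerSeries, PowerSeries.coeff_C_mul, PowerSeries.coeff_mul_C]

/-- The relations of the Yangian in terms of generating series, with `x = u⁻¹`, `y = v⁻¹`. -/
theorem isRTT_iff_series (T : ι → ι → ℕ → A) :
    IsRTT T ↔ (∀ i j, T i j 0 = if i = j then 1 else 0) ∧ ∀ i j k l,
      (PowerSeries.C PowerSeries.X - PowerSeries.X) *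
        (outerSeries (T i j) * innerSeries (T k l) - innerSeries (T k l) * outerSeries (T i j))
      = PowerSeries.X * PowerSeries.C PowerSeries.X *
        (outerSeries (T k j) * innerSeries (T i l)
          - innerSeries (T k j) * outerSeries (T i l)) := by
  constructor
  · rintro ⟨h0, h⟩
    refine ⟨h0, fun i j k l => ?_⟩
    ext r s
    rw [sub_mul, mul_assoc]
    cases r with
    | zero =>
      cases s with
      | zero => simp [PowerSeries.coeff_zero_X_mul]
      | succ s =>
        have e := coeff_outer_mul_inner (T i j) (T k l) 0 s
        have e' := coeff_inner_mul_outer (T i j) (T k l) 0 s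
        simp only [map_sub, PowerSeries.coeff_C_mul, PowerSeries.coeff_zero_X_mul,
          PowerSeries.coeff_succ_X_mul, e, e', h0, map_zero, sub_zero]
        split_ifs <;> simp
    | succ r =>
      cases s with
      | zero =>
        have e := coeff_outer_mul_inner (T i j) (T k l) r 0
        have e' := coeff_inner_mul_outer (T i j) (T k l) r 0
        simp only [map_sub, PowerSeries.coeff_C_mul, PowerSeries.coeff_zero_X_mul,
          PowerSeries.coeff_succ_X_mul, e, e', h0]
        split_ifs <;> simp
      | succ s =>
        simp only [map_sub, PowerSeries.coeff_C_mul,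
          PowerSeries.coeff_succ_X_mul, coeff_outer_mul_inner, coeff_inner_mul_outer]
        exact h i j k l r s
  · rintro ⟨h0, h⟩
    refine ⟨h0, fun i j k l r s => ?_⟩
    have e := congrArg (fun f => PowerSeries.coeff (s + 1) (PowerSeries.coeff (r + 1) f))
      (h i j k l)
    simpa only [sub_mul, mul_assoc, map_sub, PowerSeries.coeff_C_mul,
      PowerSeries.coeff_succ_X_mul, coeff_outer_mul_inner, coeff_inner_mul_outer] using e

end Series

section Product

variable {A : Type*} [Ring A] {ι : Type} [Fintype ι]

/-- The product of two matrices of series with mutually commuting entries satisfies the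
relations of the Yangian if both factors do (`f`, `g` are series in `u`; `f'`, `g'` in `v`). -/
theorem rtt_mul_aux {B : Type*} [Ring B] (D E : B) (hD : ∀ b, Commute D b)
    (hE : ∀ b, Commute E b) (f f' g g' : ι → ι → B)
    (c₁ : ∀ i j k l, Commute (f i j) (g' k l))
    (c₂ : ∀ i j k l, Commute (f' i j) (g k l))
    (hf : ∀ i j k l, D * (f i j * f' k l - f' k l * f i j)
      = E * (f k j * f' i l - f' k j * f i l))
    (hg : ∀ i j k l, D * (g i j * g' k l - g' k l * g i j)
      = E * (g k j * g' i l - g' k j * g i l)) (i j k l : ι) :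
    D * ((∑ a, f i a * g a j) * (∑ b, f' k b * g' b l)
        - (∑ b, f' k b * g' b l) * (∑ a, f i a * g a j))
      = E * ((∑ a, f k a * g a j) * (∑ b, f' i b * g' b l)
        - (∑ a, f' k a * g' a j) * (∑ b, f i b * g b l)) := by
  have term : ∀ a b,
      D * (f i a * g a j * (f' k b * g' b l) - f' k b * g' b l * (f i a * g a j))
      = E * (f k a * g a j * (f' i b * g' b l)) - E * (f' k b * g' b j * (f i a * g a l))
        + (E * (f' k b * f i a * (g b j * g' a l)) - E * (f' k a * f i b * (g a j * g' b l))) := by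
    intro a b
    have e1 : f i a * g a j * (f' k b * g' b l) = f i a * f' k b * (g a j * g' b l) := by
      rw [mul_assoc, ← mul_assoc (g a j), ← (c₂ k b a j).eq]; simp only [mul_assoc]
    have e2 : f' k b * g' b l * (f i a * g a j) = f' k b * f i a * (g' b l * g a j) := by
      rw [mul_assoc, ← mul_assoc (g' b l), ← (c₁ i a b l).eq]; simp only [mul_assoc]
    have e3 : f k a * g a j * (f' i b * g' b l) = f k a * f' i b * (g a j * g' b l) := by
      rw [mul_assoc, ← mul_assoc (g a j), ← (c₂ i b a j).eq]; simp only [mul_assoc]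
    have e4 : f' k b * g' b j * (f i a * g a l) = f' k b * f i a * (g' b j * g a l) := by
      rw [mul_assoc, ← mul_assoc (g' b j), ← (c₁ i a b j).eq]; simp only [mul_assoc]
    rw [e1, e2, e3, e4]
    have s1 : f i a * f' k b * (g a j * g' b l) - f' k b * f i a * (g' b l * g a j)
        = (f i a * f' k b - f' k b * f i a) * (g a j * g' b l)
          + f' k b * f i a * (g a j * g' b l - g' b l * g a j) := by noncomm_ring
    have hDc : D * (f' k b * f i a * (g a j * g' b l - g' b l * g a j))
        = f' k b * f i a * (D * (g a j * g' b l - g' b l * g a j)) := by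
      rw [← mul_assoc, (hD _).eq, mul_assoc]
    have hEc : ∀ z, f' k b * f i a * (E * z) = E * (f' k b * f i a * z) := by
      intro z; rw [← mul_assoc, ← (hE _).eq, mul_assoc]
    rw [s1, mul_add, ← mul_assoc D, hf, hDc, hg, hEc]
    noncomm_ring
  have swap : ∑ a, ∑ b, (E * (f' k b * f i a * (g b j * g' a l))
      - E * (f' k a * f i b * (g a j * g' b l))) = 0 := by
    simp only [Finset.sum_sub_distrib]
    rw [sub_eq_zero]
    exact Finset.sum_comm
  have L : D * ((∑ a, f i a * g a j) * (∑ b, f' k b * g' b l)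
        - (∑ b, f' k b * g' b l) * (∑ a, f i a * g a j))
      = ∑ a, ∑ b, D * (f i a * g a j * (f' k b * g' b l) - f' k b * g' b l * (f i a * g a j)) := by
    rw [Finset.sum_mul_sum, Finset.sum_mul_sum]
    rw [Finset.sum_comm (f := fun b a => f' k b * g' b l * (f i a * g a j))]
    simp only [Finset.mul_sum, Finset.sum_sub_distrib, mul_sub]
  have R : E * ((∑ a, f k a * g a j) * (∑ b, f' i b * g' b l)
        - (∑ a, f' k a * g' a j) * (∑ b, f i b * g b l))
      = ∑ a, ∑ b, (E * (f k a * g a j * (f' i b * g' b l))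
        - E * (f' k b * g' b j * (f i a * g a l))) := by
    rw [Finset.sum_mul_sum, Finset.sum_mul_sum]
    rw [Finset.sum_comm (f := fun b a => f' k b * g' b j * (f i a * g a l))]
    simp only [Finset.mul_sum, Finset.sum_sub_distrib, mul_sub]
  rw [L, R]
  simp only [term, Finset.sum_add_distrib]
  rw [swap, add_zero]

/-- The coefficients of the matrix product of two matrices of series. -/
def seriesMul (F G : ι → ι → ℕ → A) (i j : ι) (r : ℕ) : A :=
  ∑ a, ∑ x ∈ Finset.HasAntidiagonal.antidiagonal r, F i a x.1 * G a j x.2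

theorem outerSeries_seriesMul (F G : ι → ι → ℕ → A) (i j : ι) :
    outerSeries (seriesMul F G i j) = ∑ a, outerSeries (F i a) * outerSeries (G a j) := by
  ext1 r
  simp [outerSeries, seriesMul, PowerSeries.coeff_mul]

theorem innerSeries_seriesMul (F G : ι → ι → ℕ → A) (i j : ι) :
    innerSeries (seriesMul F G i j) = ∑ a, innerSeries (F i a) * innerSeries (G a j) := by
  simp only [innerSeries, ← map_mul, ← map_sum]
  congr 1
  ext r
  simp [seriesMul, PowerSeries.coeff_mul]

end Product

section Series

variable {A : Type*} [Ring A]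

theorem commute_outer_inner (a b : ℕ → A) (h : ∀ r s, Commute (a r) (b s)) :
    Commute (outerSeries a) (innerSeries b) := by
  unfold Commute SemiconjBy
  ext r s
  rw [coeff_outer_mul_inner, coeff_inner_mul_outer, (h r s).eq]

theorem IsRTT.seriesMul [Fintype ι] {F G : ι → ι → ℕ → A} (hF : IsRTT F) (hG : IsRTT G)
    (hc : ∀ i j r k l s, Commute (F i j r) (G k l s)) : IsRTT (seriesMul F G) := by
  rw [isRTT_iff_series] at hF hG ⊢
  refine ⟨fun i j => ?_, fun i j k l => ?_⟩
  · simp [_root_.seriesMul, hF.1, hG.1]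
  · have hX : ∀ b : PowerSeries (PowerSeries A), Commute (PowerSeries.X) b :=
      fun b => (PowerSeries.commute_X b).symm
    have hY : ∀ b : PowerSeries (PowerSeries A), Commute (PowerSeries.C PowerSeries.X) b := by
      intro b
      unfold Commute SemiconjBy
      ext1 r
      rw [PowerSeries.coeff_C_mul, PowerSeries.coeff_mul_C]
      exact (PowerSeries.commute_X _).symm.eq
    simp only [outerSeries_seriesMul, innerSeries_seriesMul]
    refine rtt_mul_aux _ _ (fun b => (hY b).sub_left (hX b)) (fun b => (hX b).mul_left (hY b))
      (fun i j => outerSeries (F i j)) (fun i j => innerSeries (F i j))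
      (fun i j => outerSeries (G i j)) (fun i j => innerSeries (G i j)) ?_ ?_ hF.2 hG.2 i j k l
    · exact fun i j k l => commute_outer_inner _ _ fun r s => hc i j r k l s
    · exact fun i j k l => (commute_outer_inner _ _ fun r s => (hc i j s k l r).symm).symm

end Series

theorem IsRTT.map {ι : Type} [DecidableEq ι] {A B : Type*} [Ring A] [Ring B] {T : ι → ι → ℕ → A} (hT : IsRTT T)
    (f : A →+* B) : IsRTT fun i j r => f (T i j r) where
  zero i j := by rw [hT.zero]; split_ifs <;> simp
  rel i j k l r s := by
    have h := congrArg f (hT.rel i j k l r s)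
    simpa only [map_sub, map_mul] using h

variable [Fintype ι]

namespace Yangian

/-- The comultiplication `Δ(t_ij(u)) = ∑ a, t_ia(u) ⊗ t_aj(u)`. -/
def comul : Yangian K ι →ₐ[K] Yangian K ι ⊗[K] Yangian K ι :=
  lift (seriesMul
      (fun i j r => (Algebra.TensorProduct.includeLeft :
        Yangian K ι →ₐ[K] Yangian K ι ⊗[K] Yangian K ι) (t K i j r))
      (fun i j r => (Algebra.TensorProduct.includeRight :
        Yangian K ι →ₐ[K] Yangian K ι ⊗[K] Yangian K ι) (t K i j r)))
    (IsRTT.seriesMul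
      ((isRTT_t K ι).map (AlgHom.toRingHom (Algebra.TensorProduct.includeLeft :
        Yangian K ι →ₐ[K] Yangian K ι ⊗[K] Yangian K ι)))
      ((isRTT_t K ι).map (AlgHom.toRingHom (Algebra.TensorProduct.includeRight :
        Yangian K ι →ₐ[K] Yangian K ι ⊗[K] Yangian K ι)))
      (fun i j r k l s => by
        simp [Commute, SemiconjBy, Algebra.TensorProduct.tmul_mul_tmul]))

theorem comul_t (i j : ι) (r : ℕ) :
    comul (t K i j r) = ∑ a, ∑ x ∈ Finset.HasAntidiagonal.antidiagonal r,
      t K i a x.1 ⊗ₜ[K] t K a j x.2 := by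
  unfold comul
  rw [lift_t]
  simp [seriesMul]

/-- The counit `ε(t_ij(u)) = δ_ij`. -/
def counit : Yangian K ι →ₐ[K] K :=
  lift (fun i j r => if r = 0 then (if i = j then 1 else 0) else 0)
    { zero := fun i j => by simp
      rel := fun i j k l r s => by
        rcases r with _ | r <;> rcases s with _ | s <;> simp }

/-- The evaluation homomorphism `Y(gl_n) → U(gl_n)`, `t_ij(u) ↦ δ_ij + E_ij u⁻¹`. -/
def ev : Yangian K ι →ₐ[K] UniversalEnvelopingAlgebra K (Matrix ι ι K) :=
  lift (fun i j r => match r with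
      | 0 => if i = j then 1 else 0
      | 1 => UniversalEnvelopingAlgebra.ι K (Matrix.single i j (1 : K))
      | _ + 2 => 0)
    { zero := fun i j => rfl
      rel := fun i j k l r s => by
        have br := (UniversalEnvelopingAlgebra.ι K).map_lie
          (Matrix.single i j (1 : K)) (Matrix.single k l (1 : K))
        have br2 : ⁅Matrix.single i j (1 : K), Matrix.single k l (1 : K)⁆
            = (if k = j then Matrix.single i l (1 : K) else 0)
              - (if i = l then Matrix.single k j (1 : K) else 0) := by
          rw [Ring.lie_def]
          congr 1
          · split_ifs with h
            · subst h; simp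
            · rw [Matrix.single_mul_single_of_ne _ _ _ _ (Ne.symm h)]
          · split_ifs with h
            · subst h; simp
            · rw [Matrix.single_mul_single_of_ne _ _ _ _ (Ne.symm h)]
        rw [br2, LieRing.of_associative_ring_bracket, map_sub] at br
        rcases r with _ | _ | r <;> rcases s with _ | _ | s <;> dsimp only
        all_goals first
          | (simp only [← br]; split_ifs <;> simp)
          | (split_ifs <;> simp)
          | (simp) }

end Yangian

/-! ### Tensor products of representations of the Yangian -/

namespace AlgRep

/-- The tensor product of two representations of the Yangian. -/
def tensor (M N : AlgRep K (Yangian K ι)) : AlgRep K (Yangian K ι) where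
  carrier := M.carrier ⊗[K] N.carrier
  ρ := (Module.endTensorEndAlgHom (R := K) (S := K) (A := K)
      (M := M.carrier) (N := N.carrier)).comp
    ((Algebra.TensorProduct.map M.ρ N.ρ).comp Yangian.comul)

/-- The trivial one-dimensional representation of the Yangian. -/
def trivial (K : Type u) [Field K] (ι : Type) [Fintype ι] [DecidableEq ι] :
    AlgRep K (Yangian K ι) where
  carrier := K
  ρ := (Algebra.lsmul K K K).comp Yangian.counit

/-- The tensor product `M₁ ⊗ (M₂ ⊗ (⋯ ⊗ (M_k ⊗ 1)))` of a list of representations, where `1` is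
the trivial one-dimensional representation. -/
def tensorList : List (AlgRep K (Yangian K ι)) → AlgRep K (Yangian K ι)
  | [] => trivial K ι
  | M :: l => tensor M (tensorList l)

/-- Evaluation module: a representation of `gl_n` regarded as a representation of `Y(gl_n)`. -/
def evaluation (M : AlgRep K (UniversalEnvelopingAlgebra K (Matrix ι ι K))) :
    AlgRep K (Yangian K ι) :=
  M.pullback Yangian.ev

end AlgRep

end Yangian

/-! ## Highest weight modules of `gl_2` -/

section GL2

variable {K : Type u} [Field K]

/-- The operator on `⨁ k, K f^k v` that multiplies `f^k v` by `c k`. -/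
def vermaDiag (c : ℕ → K) : Module.End K (ℕ →₀ K) :=
  Finsupp.lsum K fun k => (Finsupp.lsingle k).comp (c k • LinearMap.id)

/-- The action of `f`: it sends `f^k v` to `f^(k+1) v`. -/
def vermaF : Module.End K (ℕ →₀ K) :=
  Finsupp.lsum K fun k => Finsupp.lsingle (k + 1)

/-- The action of `e` on the Verma module of highest weight `(α, β)`:
it sends `f^k v` to `k (α - β - k + 1) f^(k-1) v`. -/
def vermaE (α β : K) : Module.End K (ℕ →₀ K) :=
  Finsupp.lsum K fun k =>
    (Finsupp.lsingle (k - 1)).comp (((k : K) * (α - β - k + 1)) • LinearMap.id)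

theorem vermaDiag_single (c : ℕ → K) (k : ℕ) (x : K) :
    vermaDiag c (Finsupp.single k x) = Finsupp.single k (c k * x) := by
  simp [vermaDiag]

theorem vermaF_single (k : ℕ) (x : K) :
    vermaF (Finsupp.single k x) = Finsupp.single (k + 1) x := by
  simp [vermaF]

theorem vermaE_single (α β : K) (k : ℕ) (x : K) :
    vermaE α β (Finsupp.single k x)
      = Finsupp.single (k - 1) ((k : K) * (α - β - k + 1) * x) := by
  unfold vermaE
  rw [Finsupp.lsum_single, LinearMap.comp_apply, LinearMap.smul_apply, LinearMap.id_apply,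
    Finsupp.lsingle_apply, smul_eq_mul]

/-- The Verma module `M(α, β)` of `gl_2`, with basis `f^k v` (`k ≥ 0`), where `f = E₂₁`, `e = E₁₂`,
`e v = 0`, `E₁₁ v = α v`, `E₂₂ v = β v`. -/
def vermaHom (α β : K) : Matrix (Fin 2) (Fin 2) K →ₗ⁅K⁆ Module.End K (ℕ →₀ K) where
  toFun A := A 0 0 • vermaDiag (fun k => α - k) + A 1 1 • vermaDiag (fun k => β + k)
    + A 0 1 • vermaE α β + A 1 0 • vermaF
  map_add' A B := by simp only [Matrix.add_apply, add_smul]; abel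
  map_smul' c A := by simp [mul_smul]
  map_lie' := fun {A B} => by
    refine Finsupp.lhom_ext' fun k => LinearMap.ext_ring ?_
    rcases k with _ | k
    all_goals
      simp only [LinearMap.comp_apply, Finsupp.lsingle_apply, Ring.lie_def, LinearMap.sub_apply,
        Module.End.mul_apply, LinearMap.add_apply, LinearMap.smul_apply, vermaDiag_single,
        vermaE_single, vermaF_single, map_add, map_smul, Matrix.sub_apply, Matrix.mul_apply,
        Fin.sum_univ_two, Nat.add_sub_cancel, Nat.zero_sub]
      ext m
      simp only [Finsupp.sub_apply, Finsupp.add_apply, Finsupp.smul_apply, Finsupp.single_apply,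
        smul_eq_mul]
      split_ifs <;> first | omega | (push_cast; ring)

/-- The Verma module as a representation of the universal enveloping algebra of `gl_2`. -/
def verma (α β : K) : AlgRep K (UniversalEnvelopingAlgebra K (Matrix (Fin 2) (Fin 2) K)) where
  carrier := ℕ →₀ K
  ρ := UniversalEnvelopingAlgebra.lift K (vermaHom α β)

/-- The irreducible highest weight module `L(α, β)` of `gl_2`: the quotient of the Verma module by
the largest submodule contained in the span of the `f^k v` with `k ≥ 1` (the kernel of the
coefficient of `v`). In characteristic `p` the Verma module also has irreducible quotients on which
`f ^ p` acts by a nonzero scalar; this is the one graded by the powers of `f`, with basis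
`f^k v` for `0 ≤ k ≤ l`, where `l + 1` is the least `k ≥ 1` with `k (α - β - k + 1) = 0`. -/
def irrHW (α β : K) : AlgRep K (UniversalEnvelopingAlgebra K (Matrix (Fin 2) (Fin 2) K)) :=
  (verma α β).quotient ((verma α β).largestSubrepInKer (Finsupp.lapply 0))
    (AlgRep.isSubrep_largestSubrepInKer _ _)

end GL2

/-! ## The ordering of the parameters -/

section Order

variable (p : ℕ) [Fact p.Prime]

/-- The element `x` of the algebraic closure of `𝔽_p` lies in `𝔽_p`. -/
def InPrimeField (x : AlgebraicClosure (ZMod p)) : Prop :=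
  x ∈ Set.range (algebraMap (ZMod p) (AlgebraicClosure (ZMod p)))

/-- `[x]`: the least natural number whose residue modulo `p` is `x`; used only for `x ∈ 𝔽_p`. -/
def leastResidue (x : AlgebraicClosure (ZMod p)) : ℕ :=
  sInf {m : ℕ | (m : AlgebraicClosure (ZMod p)) = x}

/-- For every `i`: if `[α_i - β_i]` is defined, it is minimal among all defined `[α_j - β_l]` with
`j, l ≥ i`; if it is not defined, then no `[α_j - β_l]` with `j, l ≥ i` is defined. -/
def IsMinimallyOrdered {k : ℕ} (α β : Fin k → AlgebraicClosure (ZMod p)) : Prop :=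
  ∀ i : Fin k,
    (InPrimeField p (α i - β i) → ∀ j l : Fin k, i ≤ j → i ≤ l → InPrimeField p (α j - β l) →
      leastResidue p (α i - β i) ≤ leastResidue p (α j - β l)) ∧
    (¬ InPrimeField p (α i - β i) → ∀ j l : Fin k, i ≤ j → i ≤ l → ¬ InPrimeField p (α j - β l))

end Order

end

/-! On a product of `k` evaluation modules the series `t_ij(u)` are polynomials in `u⁻¹` of degree
at most `k`. Irreducibility follows from two statements: the vectors killed by `t_12(u)` form a line
`K η`, and the functionals killed by the transpose of `t_21(u)` form a line `K φ`, with `φ η = 1`.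
Both series strictly lower an exhausting finite filtration, so every nonzero subrepresentation
contains `η`. The annihilator of a proper one contains `φ`, and `φ η = 1` excludes both at once
(`AlgRep.isIrreducible_of_isLadder`).

Both lines are found by splitting off the first factor `L(α, β)`. Write `ζ = ∑ e_s ⊗ ζ_s`. The
coordinate of `t_12(u) ζ` at `e_s` is `(1 + (α - s) u⁻¹) t_12(u) ζ_s + (s + 1)(α - β - s) u⁻¹
t_22(u) ζ_{s+1}`. Let this vanish for all `s`. Descending from the top, once `ζ_{s+2} = 0`, the
vector `ζ_{s+1}` is singular, hence equals `c η'` with `η'` the singular vector of the remaining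
factors, on which `t_22(u)` acts by `∏ (1 + β_j u⁻¹)`. Since `t_12(u) ζ_s` is polynomial in `u⁻¹`,
setting `u = -(α - s)` after clearing denominators gives `c ∏ (β_j - α + s) = 0`. Minimality of `[α
- β]` ensures `α - β_j ≠ s` for `s < l`, so `c = 0`. Only `ζ_0` survives, and it is a multiple of
`η'`. The dual statement is the same computation with `α` and `β` exchanged, and needs `α_j - β ≠
s`. `IsLadder.step` treats both cases; the ordering of the parameters supplies the inequalities. -/

noncomputable section

universe u

/-! ### Singular vectors from two-term recursions -/

section Ladder

variable {K : Type*} [Field K] {X : Type*} [AddCommGroup X] [Module K X]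
  {X' : Type*} [AddCommGroup X'] [Module K X']

/-- Operators `a r`, `d r` (the coefficients of a raising series and of a diagonal series) for which
`η` is, up to scalars, the only vector killed by all `a r`; the diagonal series acts on `η` by
`∏ (1 + δ u⁻¹)`, where `δ` runs through the list `δs`. -/
structure IsLadder (a d : ℕ → Module.End K X) (η : X) (δs : List K) : Prop where
  raise_zero : a 0 = 0
  diag_zero : d 0 = 1
  raise_eq_zero : ∀ r, δs.length < r → a r = 0
  diag_eq_zero : ∀ r, δs.length < r → d r = 0
  ne_zero : η ≠ 0
  raise_apply : ∀ r, a r η = 0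
  sum_diag_apply : ∀ x : K, ∑ r ∈ Finset.range (δs.length + 1), x ^ (δs.length - r) • d r η
    = (δs.map (x + ·)).prod • η
  singular : ∀ ζ, (∀ r, a r ζ = 0) → ∃ c : K, ζ = c • η
  filtration : ∃ F : ℕ → Submodule K X, F 0 = ⊥ ∧ Monotone F ∧ (∃ N, F N = ⊤) ∧
    (∀ r n, ∀ x ∈ F n, a r x ∈ F (n - 1)) ∧ ∀ r n, ∀ x ∈ F n, d r x ∈ F n

/-- A nonzero vector of `N` in the lowest possible filtration step is killed by every `a r`, since
its images lie in `N` and one step lower. It is therefore a nonzero multiple of `η`. -/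
theorem IsLadder.mem {a d : ℕ → Module.End K X} {η : X} {δs : List K} (h : IsLadder a d η δs)
    (N : Submodule K X) (hN : N ≠ ⊥) (ha : ∀ r, ∀ x ∈ N, a r x ∈ N) : η ∈ N := by
  classical
  obtain ⟨F, hF0, -, ⟨M, hM⟩, hFa, -⟩ := h.filtration
  obtain ⟨x, hx, hx0⟩ := N.ne_bot_iff.1 hN
  have hex : ∃ n, ∃ x ∈ N, x ≠ 0 ∧ x ∈ F n := ⟨M, x, hx, hx0, hM ▸ Submodule.mem_top⟩
  obtain ⟨y, hy, hy0, hyF⟩ := Nat.find_spec hex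
  have hpos : Nat.find hex ≠ 0 := by
    intro h0
    rw [h0, hF0] at hyF
    exact hy0 ((Submodule.mem_bot K).1 hyF)
  obtain ⟨c, rfl⟩ := h.singular y fun r => by
    by_contra hne
    exact Nat.find_min hex (Nat.sub_lt (Nat.pos_of_ne_zero hpos) one_pos)
      ⟨a r y, ha r y hy, hne, hFa r _ y hyF⟩
  have hc : c ≠ 0 := by rintro rfl; simp at hy0
  exact (N.smul_mem_iff hc).1 hy

/-- A ladder over a ladder: `X` has coordinates `C s` in `X'`, for `0 ≤ s ≤ l`, in which the
operators are given by two-term recursions. -/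
theorem IsLadder.step {a d : ℕ → Module.End K X} {a' d' : ℕ → Module.End K X'}
    {η : X} {η' : X'} {δs : List K} (H : IsLadder a' d' η' δs)
    (C : ℕ → X →ₗ[K] X') (l : ℕ) (g h μ ν : ℕ → K)
    (hC : ∀ ζ, (∀ s, C s ζ = 0) → ζ = 0) (hCl : ∀ s, l < s → C s = 0)
    (ha0 : a 0 = 0) (hd0 : d 0 = 1)
    (ha : ∀ n s ζ, C s (a (n + 1) ζ) = a' (n + 1) (C s ζ) + g s • a' n (C s ζ)
      + μ s • d' n (C (s + 1) ζ))
    (hdz : ∀ n ζ, C 0 (d (n + 1) ζ) = d' (n + 1) (C 0 ζ) + h 0 • d' n (C 0 ζ))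
    (hds : ∀ n s ζ, C (s + 1) (d (n + 1) ζ) = d' (n + 1) (C (s + 1) ζ)
      + h (s + 1) • d' n (C (s + 1) ζ) + ν s • a' n (C s ζ))
    (hη0 : C 0 η = η') (hηs : ∀ s, C (s + 1) η = 0)
    (hμ : ∀ s < l, μ s ≠ 0) (hg : ∀ s < l, ((δs.map (-g s + ·)).prod ≠ 0)) :
    IsLadder a d η (h 0 :: δs) where
  raise_zero := ha0
  diag_zero := hd0
  raise_eq_zero r hr := by
    obtain _ | r := r
    · exact ha0
    simp only [List.length_cons, add_lt_add_iff_right] at hr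
    refine LinearMap.ext fun ζ => hC _ fun s => ?_
    rw [ha, H.raise_eq_zero _ hr, H.raise_eq_zero _ (by omega), H.diag_eq_zero _ hr]
    simp
  diag_eq_zero r hr := by
    obtain _ | r := r
    · simp at hr
    simp only [List.length_cons, add_lt_add_iff_right] at hr
    refine LinearMap.ext fun ζ => hC _ fun s => ?_
    obtain _ | s := s
    · rw [hdz, H.diag_eq_zero _ hr, H.diag_eq_zero _ (by omega)]
      simp
    · rw [hds, H.raise_eq_zero _ hr, H.diag_eq_zero _ (by omega), H.diag_eq_zero _ hr]
      simp
  ne_zero := by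
    rintro rfl
    exact H.ne_zero (by simpa using hη0.symm)
  raise_apply r := by
    obtain _ | r := r
    · simp [ha0]
    refine hC _ fun s => ?_
    rw [ha, hηs]
    obtain _ | s := s
    · simp [hη0, H.raise_apply]
    · simp [hηs]
  sum_diag_apply x := by
    rw [← sub_eq_zero]
    refine hC _ fun s => ?_
    obtain _ | s := s
    · simp only [map_sub, map_sum, map_smul, List.length_cons, List.map_cons, List.prod_cons, hη0]
      rw [sub_eq_zero, mul_smul, ← H.sum_diag_apply x, Finset.sum_range_succ']
      simp only [hdz, hη0, hd0, Module.End.one_apply, Nat.add_sub_add_right, smul_add,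
        Finset.sum_add_distrib, Nat.sub_zero, add_smul]
      -- Coordinate `0` of the new series acts as `(1 + h 0 u⁻¹) d'(u)`, which yields the factor `x
      -- + h 0`. The index shift costs nothing at the top, where `d'` vanishes beyond the degree,
      -- and the extra bottom term comes from `d' 0 = 1`.
      have e1 : ∑ r ∈ Finset.range (δs.length + 1), x ^ (δs.length - r) • d' (r + 1) η'
          + x ^ (δs.length + 1) • η'
          = x • ∑ r ∈ Finset.range (δs.length + 1), x ^ (δs.length - r) • d' r η' := by
        rw [Finset.sum_range_succ, H.diag_eq_zero _ (Nat.lt_succ_self _), Finset.sum_range_succ',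
          smul_add, Finset.smul_sum]
        simp only [LinearMap.zero_apply, smul_zero, add_zero, H.diag_zero, Module.End.one_apply,
          Nat.sub_zero, smul_smul, ← pow_succ']
        congr 1
        refine Finset.sum_congr rfl fun r hr => ?_
        rw [Finset.mem_range] at hr
        congr 2
        omega
      have e2 : ∑ r ∈ Finset.range (δs.length + 1), x ^ (δs.length - r) • h 0 • d' r η'
          = h 0 • ∑ r ∈ Finset.range (δs.length + 1), x ^ (δs.length - r) • d' r η' := by
        rw [Finset.smul_sum]
        exact Finset.sum_congr rfl fun r _ => smul_comm _ _ _
      rw [← e1, ← e2]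
      abel
    · have hz : ∀ r, C (s + 1) (d r η) = 0 := by
        intro r
        obtain _ | r := r
        · simp [hd0, hηs]
        rw [hds, hηs]
        obtain _ | s := s
        · simp [hη0, H.raise_apply]
        · simp [hηs]
      simp [hz, hηs]
  singular ζ hζ := by
    -- Here `(1 + g s u⁻¹) a'(u)` kills `C s ζ`; the scalar series is invertible, so `a'(u)` kills
    -- it too.
    have prop : ∀ s, C (s + 1) ζ = 0 → ∃ c : K, C s ζ = c • η' := by
      intro s hs
      refine H.singular _ fun r => ?_
      induction r with
      | zero => simp [H.raise_zero]
      | succ r ih =>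
        have := ha r s ζ
        rw [hζ, hs, ih] at this
        simpa using this.symm
    have vanish : ∀ s < l, ∀ c : K, C (s + 1) ζ = c • η' → c = 0 := by
      intro s hs c hc
      have two_term : ∀ r, a' (r + 1) (C s ζ)
          = (-g s) • a' r (C s ζ) - (μ s * c) • d' r η' := by
        intro r
        have hr := ha r s ζ
        rw [hζ, hc, map_zero, map_smul, smul_smul] at hr
        rw [neg_smul, ← sub_eq_zero, hr]
        abel
      -- The recursion is solved by expanding `(1 + g s u⁻¹)⁻¹` as a geometric series.
      have closed : ∀ r, a' (r + 1) (C s ζ)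
          = -((μ s * c) • ∑ i ∈ Finset.range (r + 1), (-g s) ^ (r - i) • d' i η') := by
        intro r
        induction r with
        | zero => rw [two_term]; simp [H.raise_zero]
        | succ r ih =>
          rw [two_term, ih, Finset.sum_range_succ _ (r + 1), Nat.sub_self, pow_zero, one_smul,
            smul_add, smul_neg, smul_comm (-g s), Finset.smul_sum (r := -g s), neg_add,
            ← sub_eq_add_neg]
          congr 3
          refine Finset.sum_congr rfl fun i hi => ?_
          rw [Finset.mem_range] at hi
          rw [smul_smul, ← pow_succ']
          congr 2
          omega
      -- One index past the degree the left side is zero, while the sum on the right is the diagonal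
      -- polynomial at `x = -g s`, that is, `∏ (δ - g s)`.
      have := closed δs.length
      rw [H.raise_eq_zero _ (Nat.lt_succ_self _), H.sum_diag_apply, LinearMap.zero_apply, eq_comm,
        neg_eq_zero, smul_smul, smul_eq_zero_iff_left H.ne_zero] at this
      simpa [hμ s hs, hg s hs] using this
    -- Descending induction on `s`, with `j` bounding the distance to the top coordinate `l`.
    have high : ∀ j s, l ≤ s + j → C (s + 1) ζ = 0 := by
      intro j
      induction j with
      | zero => intro s hs; rw [hCl _ (by omega)]; rfl
      | succ j ih =>
        intro s hs
        obtain hls | hls := le_or_gt l s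
        · rw [hCl _ (by omega)]; rfl
        obtain ⟨c, hc⟩ := prop (s + 1) (ih (s + 1) (by omega))
        rw [hc, vanish s hls c hc, zero_smul]
    obtain ⟨c, hc⟩ := prop 0 (high l 0 (by omega))
    refine ⟨c, ?_⟩
    rw [← sub_eq_zero]
    refine hC _ fun s => ?_
    obtain _ | s := s
    · simp [hc, hη0]
    · simp [high l s (by omega), hηs]
  filtration := by
    obtain ⟨F, hF0, hFm, ⟨N, hN⟩, hFa, hFd⟩ := H.filtration
    -- Coordinate `s` carries weight `s`, so it is allowed only `n - s` of the old filtration;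
    -- truncated subtraction is harmless because `F 0 = ⊥`.
    refine ⟨fun n => ⨅ s, (F (n - s)).comap (C s), ?_, ?_, ⟨N + l, ?_⟩, ?_, ?_⟩
    · rw [eq_bot_iff]
      intro ζ hζ
      simp only [Nat.zero_sub, hF0, Submodule.mem_iInf, Submodule.mem_comap,
        Submodule.mem_bot] at hζ
      exact hC _ hζ
    · intro m n hmn
      exact iInf_mono fun s => Submodule.comap_mono (hFm (by omega))
    · rw [eq_top_iff]
      intro ζ _
      simp only [Submodule.mem_iInf, Submodule.mem_comap]
      intro s
      obtain hs | hs := le_or_gt s l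
      · exact hFm (show N ≤ N + l - s by omega) (hN ▸ Submodule.mem_top)
      · rw [hCl s hs]
        exact Submodule.zero_mem _
    · intro r n ζ hζ
      simp only [Submodule.mem_iInf, Submodule.mem_comap] at hζ ⊢
      intro s
      obtain _ | r := r
      · simp [ha0]
      have hs := hζ s
      have e : n - 1 - s = n - s - 1 := by omega
      rw [ha, e]
      refine add_mem (add_mem (hFa _ _ _ hs) (Submodule.smul_mem _ _ (hFa _ _ _ hs)))
        (Submodule.smul_mem _ _ ?_)
      exact hFd _ _ _ (hζ (s + 1))
    · intro r n ζ hζ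
      simp only [Submodule.mem_iInf, Submodule.mem_comap] at hζ ⊢
      intro s
      obtain _ | r := r
      · simpa [hd0] using hζ s
      have hs := hζ s
      obtain _ | s := s
      · rw [hdz]
        exact add_mem (hFd _ _ _ hs) (Submodule.smul_mem _ _ (hFd _ _ _ hs))
      · rw [hds]
        refine add_mem (add_mem (hFd _ _ _ hs) (Submodule.smul_mem _ _ (hFd _ _ _ hs)))
          (Submodule.smul_mem _ _ ?_)
        exact hFa r _ _ (hζ s)

end Ladder

/-! ### The weight basis of `L(α, β)` -/

section WeightBasis

variable {K : Type u} [Field K]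

/-- The action of the matrix unit `E_ij` on a representation of `gl_2`. -/
def AlgRep.unitAct (M : AlgRep K (UniversalEnvelopingAlgebra K (Matrix (Fin 2) (Fin 2) K)))
    (i j : Fin 2) : Module.End K M.carrier :=
  M.ρ (UniversalEnvelopingAlgebra.ι K (Matrix.single i j (1 : K)))

/-- A basis `e 0, …, e l` of a highest weight module of `gl_2` with highest weight `(α, β)`, with
dual basis `c 0, …, c l`, both extended by zero. -/
structure WeightBasis (α β : K) (l : ℕ)
    (M : AlgRep K (UniversalEnvelopingAlgebra K (Matrix (Fin 2) (Fin 2) K))) where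
  e : ℕ → M.carrier
  c : ℕ → M.carrier →ₗ[K] K
  span_e : Submodule.span K (Set.range e) = ⊤
  e_eq_zero : ∀ r, l < r → e r = 0
  c_eq_zero : ∀ s, l < s → c s = 0
  c_e : ∀ s r, r ≤ l → c s (e r) = if s = r then 1 else 0
  act_zero_zero : ∀ r, M.unitAct 0 0 (e r) = (α - r) • e r
  act_one_one : ∀ r, M.unitAct 1 1 (e r) = (β + r) • e r
  act_one_zero : ∀ r, M.unitAct 1 0 (e r) = e (r + 1)
  act_zero_one_zero : M.unitAct 0 1 (e 0) = 0
  act_zero_one_succ : ∀ r, M.unitAct 0 1 (e (r + 1)) = (((r : K) + 1) * (α - β - r)) • e r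

theorem verma_unitAct (α β : K) (i j : Fin 2) :
    (verma α β).unitAct i j = vermaHom α β (Matrix.single i j 1) := by
  unfold AlgRep.unitAct verma
  exact UniversalEnvelopingAlgebra.lift_ι_apply K (vermaHom α β) _

theorem vermaHom_zero_zero (α β : K) :
    vermaHom α β (Matrix.single 0 0 1) = vermaDiag (fun k => α - k) := by
  simp [vermaHom]

theorem vermaHom_one_one (α β : K) :
    vermaHom α β (Matrix.single 1 1 1) = vermaDiag (fun k => β + k) := by
  simp [vermaHom]

theorem vermaHom_zero_one (α β : K) :
    vermaHom α β (Matrix.single 0 1 1) = vermaE α β := by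
  simp [vermaHom]

theorem vermaHom_one_zero (α β : K) :
    vermaHom α β (Matrix.single 1 0 1) = vermaF := by
  simp [vermaHom]

/-- A subspace stable under the Lie algebra is stable under its enveloping algebra. -/
theorem AlgRep.isSubrep_of_lie {L : Type*} [LieRing L] [LieAlgebra K L]
    (M : AlgRep K (UniversalEnvelopingAlgebra K L)) (W : Submodule K M.carrier)
    (h : ∀ x : L, ∀ w ∈ W, M.ρ (UniversalEnvelopingAlgebra.ι K x) w ∈ W) : M.IsSubrep W := by
  let S : Subalgebra K (UniversalEnvelopingAlgebra K L) :=
    { carrier := {a | ∀ w ∈ W, M.ρ a w ∈ W}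
      mul_mem' := fun {a b} ha hb w hw => by
        rw [map_mul]; exact ha _ (hb w hw)
      add_mem' := fun {a b} ha hb w hw => by
        rw [map_add]; exact W.add_mem (ha w hw) (hb w hw)
      algebraMap_mem' := fun c w hw => by
        rw [AlgHom.commutes, Module.algebraMap_end_apply]; exact W.smul_mem c hw }
  let f : L →ₗ⁅K⁆ S :=
    { toFun := fun x => ⟨UniversalEnvelopingAlgebra.ι K x, h x⟩
      map_add' := fun x y => Subtype.ext (map_add _ x y)
      map_smul' := fun c x => Subtype.ext (map_smul _ c x)
      map_lie' := fun {x y} => Subtype.ext (LieHom.map_lie _ x y) }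
  -- By uniqueness in the universal property, the subalgebra `S` of elements preserving `W` is the
  -- whole enveloping algebra.
  have key : S.val.comp (UniversalEnvelopingAlgebra.lift K f) = AlgHom.id K _ := by
    ext x
    simp [f]
  intro a
  have := congrArg (fun φ => φ a) key
  simp only [AlgHom.comp_apply, Subalgebra.coe_val, AlgHom.id_apply] at this
  rw [← this]
  exact (UniversalEnvelopingAlgebra.lift K f a).2

theorem vermaE_pow_apply_zero (α β : K) (m : ℕ) (x : ℕ →₀ K) :
    (vermaE α β ^ m) x 0 = (∏ j ∈ Finset.range m, ((j : K) + 1) * (α - β - j)) * x m := by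
  have one : ∀ (x : ℕ →₀ K) (s : ℕ),
      vermaE α β x s = ((s : K) + 1) * (α - β - s) * x (s + 1) := by
    intro x s
    induction x using Finsupp.induction_linear with
    | zero => simp
    | add f g hf hg => simp [hf, hg, mul_add]
    | single k c =>
      rw [vermaE_single]
      obtain _ | k := k
      · simp
      · simp only [Nat.add_sub_cancel, Finsupp.single_apply, Nat.add_right_cancel_iff]
        split_ifs with h
        · subst h; push_cast; ring
        · simp
  -- All coordinates are needed for the induction, since each application of `e` shifts the index.
  have gen : ∀ s, (vermaE α β ^ m) x s
      = (∏ j ∈ Finset.range m, (((s + j : ℕ) : K) + 1) * (α - β - (s + j : ℕ))) * x (s + m) := by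
    induction m with
    | zero => simp
    | succ m ih =>
      intro s
      rw [pow_succ', Module.End.mul_apply, one, ih, Finset.prod_range_succ']
      have e : s + 1 + m = s + (m + 1) := by omega
      simp only [e, Nat.add_zero, show ∀ j, s + 1 + j = s + (j + 1) by intro j; omega]
      ring
  simpa using gen 0

/-- For `s ≤ l`, applying `e ^ s` brings the coefficient of `f^s v` to `v` with a nonzero factor, so
it must vanish. Conversely, the span of the `f^s v` with `s > l` is a submodule, because `e f^(l+1)
v = (l + 1)(α - β - l) f^l v = 0`. -/
theorem mem_largestSubrepInKer_verma {α β : K} {l : ℕ}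
    (hl : ((l : K) + 1) * (α - β - l) = 0) (hlt : ∀ m < l, ((m : K) + 1) * (α - β - m) ≠ 0)
    (x : ℕ →₀ K) :
    x ∈ (verma α β).largestSubrepInKer (Finsupp.lapply 0) ↔ ∀ s ≤ l, x s = 0 := by
  constructor
  · intro hx s hs
    have h := hx ((UniversalEnvelopingAlgebra.ι K (Matrix.single 0 1 (1 : K))) ^ s)
    have e : (verma α β).ρ (UniversalEnvelopingAlgebra.ι K (Matrix.single 0 1 (1 : K)))
        = vermaE α β := (verma_unitAct α β 0 1).trans (vermaHom_zero_one α β)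
    rw [map_pow, e] at h
    have h2 := (vermaE_pow_apply_zero α β s x).symm.trans h
    refine (mul_eq_zero.1 h2).resolve_left ?_
    exact Finset.prod_ne_zero_iff.2 fun j hj => hlt j (by rw [Finset.mem_range] at hj; omega)
  · intro hx
    let W : Submodule K (verma α β).carrier :=
      ((Finsupp.supported K K {s : ℕ | l < s} : Submodule K (ℕ →₀ K)))
    have hW : (verma α β).IsSubrep W := by
      refine AlgRep.isSubrep_of_lie _ _ fun A w hw => ?_
      have e : (verma α β).ρ (UniversalEnvelopingAlgebra.ι K A) = vermaHom α β A :=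
        UniversalEnvelopingAlgebra.lift_ι_apply K (vermaHom α β) _
      rw [e]
      have hw' : w ∈ Submodule.span K ((fun i => Finsupp.single i (1 : K)) '' {s : ℕ | l < s}) := by
        rw [← Finsupp.supported_eq_span_single]; exact hw
      suffices h : Submodule.span K ((fun i => Finsupp.single i (1 : K)) '' {s : ℕ | l < s})
          ≤ (Finsupp.supported K K {s : ℕ | l < s}).comap (vermaHom α β A) from h hw'
      rw [Submodule.span_le]
      rintro _ ⟨s, hs, rfl⟩
      have hs' : l < s := hs
      change vermaHom α β A (Finsupp.single s 1) ∈ Finsupp.supported K K {s : ℕ | l < s}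
      have hA : vermaHom α β A (Finsupp.single s 1)
          = A 0 0 • Finsupp.single s ((α - s) * 1) + A 1 1 • Finsupp.single s ((β + s) * 1)
            + A 0 1 • Finsupp.single (s - 1) ((s : K) * (α - β - s + 1) * 1)
            + A 1 0 • Finsupp.single (s + 1) 1 := by
        rw [← vermaDiag_single (fun k => α - k), ← vermaDiag_single (fun k => β + k),
          ← vermaE_single, ← vermaF_single]
        rfl
      rw [hA]
      refine add_mem (add_mem (add_mem ?_ ?_) ?_) ?_ <;> refine Submodule.smul_mem _ _ ?_
      · exact Finsupp.single_mem_supported K _ hs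
      · exact Finsupp.single_mem_supported K _ hs
      · obtain h | h := (show l + 1 = s ∨ l < s - 1 by omega)
        · subst h
          have : ((l + 1 : ℕ) : K) * (α - β - (l + 1 : ℕ) + 1) * 1 = 0 := by
            rw [← hl]; push_cast; ring
          rw [this, Finsupp.single_zero]
          exact Submodule.zero_mem _
        · exact Finsupp.single_mem_supported K _ h
      · exact Finsupp.single_mem_supported K _ (show l < s + 1 by omega)
    have hxW : x ∈ W := by
      refine (Finsupp.mem_supported' K x).2 fun s hs => hx s ?_
      exact not_lt.1 hs
    intro a
    have := (Finsupp.mem_supported' K _).1 (hW a x hxW) 0 (by simp)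
    exact this

theorem span_range_mkQ {V ι : Type*} [AddCommGroup V] [Module K V] (W : Submodule K V) (b : ι → V)
    (hb : Submodule.span K (Set.range b) = ⊤) :
    Submodule.span K (Set.range fun r => W.mkQ (b r)) = ⊤ := by
  rw [show (Set.range fun r => W.mkQ (b r)) = W.mkQ '' Set.range b from Set.range_comp _ _,
    Submodule.span_image, hb, Submodule.map_top, Submodule.range_mkQ]

theorem span_range_single_one {ι : Type*} :
    Submodule.span K (Set.range fun r : ι => (Finsupp.single r (1 : K) : ι →₀ K)) = ⊤ := by
  have := Finsupp.supported_eq_span_single K (Set.univ : Set ι)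
  rw [Finsupp.supported_univ, Set.image_univ] at this
  exact this.symm

/-- The weight basis of `L(α, β)`, where `l + 1` is the least `k ≥ 1` with
`k (α - β - k + 1) = 0`. -/
def irrHWBasis {α β : K} {l : ℕ} (hl : ((l : K) + 1) * (α - β - l) = 0)
    (hlt : ∀ m < l, ((m : K) + 1) * (α - β - m) ≠ 0) : WeightBasis α β l (irrHW α β) where
  e r := Submodule.mkQ ((verma α β).largestSubrepInKer (Finsupp.lapply 0))
    (Finsupp.single r (1 : K) : ℕ →₀ K)
  c s := Submodule.liftQ ((verma α β).largestSubrepInKer (Finsupp.lapply 0))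
    -- Coefficients beyond `l` do not descend to the quotient and are replaced by zero.
    ((if s ≤ l then (1 : K) else 0) • (Finsupp.lapply s : (ℕ →₀ K) →ₗ[K] K)) fun x hx => by
      have h := (mem_largestSubrepInKer_verma hl hlt x).1 hx s
      change (if s ≤ l then (1 : K) else 0) * (show ℕ →₀ K from x) s = 0
      split_ifs with hs
      · rw [h hs, mul_zero]
      · rw [zero_mul]
  span_e := span_range_mkQ (V := (verma α β).carrier) _
    (fun r => (Finsupp.single r (1 : K) : ℕ →₀ K)) span_range_single_one
  e_eq_zero r hr := by
    refine (Submodule.Quotient.mk_eq_zero _).2 ((mem_largestSubrepInKer_verma hl hlt _).2 ?_)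
    intro s hs
    exact Finsupp.single_eq_of_ne (by omega)
  c_eq_zero s hs := by
    refine LinearMap.ext fun x => ?_
    obtain ⟨x, rfl⟩ := Submodule.mkQ_surjective _ x
    refine (Submodule.liftQ_apply _ _ _).trans ?_
    change (if s ≤ l then (1 : K) else 0) * (show ℕ →₀ K from x) s = 0
    rw [if_neg (by omega), zero_mul]
  c_e s r hr := by
    refine (Submodule.liftQ_apply _ _ _).trans ?_
    change (if s ≤ l then (1 : K) else 0) * (Finsupp.single r (1 : K)) s = _
    rw [Finsupp.single_apply]
    split_ifs <;> first | omega | simp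
  act_zero_zero r := congrArg (Submodule.mkQ _)
    ((LinearMap.congr_fun ((verma_unitAct α β 0 0).trans (vermaHom_zero_zero α β)) _).trans
      ((vermaDiag_single _ r 1).trans (Finsupp.smul_single (α - (r : K)) r (1 : K)).symm))
  act_one_one r := congrArg (Submodule.mkQ _)
    ((LinearMap.congr_fun ((verma_unitAct α β 1 1).trans (vermaHom_one_one α β)) _).trans
      ((vermaDiag_single _ r 1).trans (Finsupp.smul_single (β + (r : K)) r (1 : K)).symm))
  act_one_zero r := congrArg (Submodule.mkQ _)
    ((LinearMap.congr_fun ((verma_unitAct α β 1 0).trans (vermaHom_one_zero α β)) _).trans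
      (vermaF_single r 1))
  act_zero_one_zero := (congrArg (Submodule.mkQ _)
    ((LinearMap.congr_fun ((verma_unitAct α β 0 1).trans (vermaHom_zero_one α β)) _).trans
      ((vermaE_single α β 0 1).trans
        ((congrArg (Finsupp.single 0) (by simp)).trans (Finsupp.single_zero 0))))).trans (map_zero _)
  act_zero_one_succ r := congrArg (Submodule.mkQ _)
    ((LinearMap.congr_fun ((verma_unitAct α β 0 1).trans (vermaHom_zero_one α β)) _).trans
      ((vermaE_single α β (r + 1) 1).trans (Eq.trans
        (congrArg (Finsupp.single r) (by push_cast; rw [smul_eq_mul]; ring))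
          (Finsupp.smul_single _ r (1 : K)).symm)))

end WeightBasis

/-! ### Coordinates with respect to a weight basis -/

namespace WeightBasis

variable {K : Type u} [Field K] {α β : K} {l : ℕ}
  {M : AlgRep K (UniversalEnvelopingAlgebra K (Matrix (Fin 2) (Fin 2) K))}

theorem hom_ext (b : WeightBasis α β l M) {V : Type*} [AddCommGroup V] [Module K V]
    {f g : M.carrier →ₗ[K] V} (h : ∀ r ≤ l, f (b.e r) = g (b.e r)) : f = g := by
  refine LinearMap.ext_on_range b.span_e fun r => ?_
  obtain hr | hr := le_or_gt r l
  · exact h r hr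
  · rw [b.e_eq_zero r hr, map_zero, map_zero]

theorem c_act_zero_zero (b : WeightBasis α β l M) (s : ℕ) (x : M.carrier) :
    b.c s (M.unitAct 0 0 x) = (α - s) * b.c s x := by
  refine LinearMap.congr_fun (f := (b.c s).comp (M.unitAct 0 0)) (g := (α - s) • b.c s)
    (b.hom_ext fun r hr => ?_) x
  simp only [LinearMap.comp_apply, LinearMap.smul_apply, b.act_zero_zero, map_smul, b.c_e s r hr]
  split_ifs with h
  · rw [h]
  · simp

theorem c_act_one_one (b : WeightBasis α β l M) (s : ℕ) (x : M.carrier) :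
    b.c s (M.unitAct 1 1 x) = (β + s) * b.c s x := by
  refine LinearMap.congr_fun (f := (b.c s).comp (M.unitAct 1 1)) (g := (β + s) • b.c s)
    (b.hom_ext fun r hr => ?_) x
  simp only [LinearMap.comp_apply, LinearMap.smul_apply, b.act_one_one, map_smul, b.c_e s r hr]
  split_ifs with h
  · rw [h]
  · simp

theorem c_act_zero_one (b : WeightBasis α β l M) (s : ℕ) (x : M.carrier) :
    b.c s (M.unitAct 0 1 x) = (((s : K) + 1) * (α - β - s)) * b.c (s + 1) x := by
  refine LinearMap.congr_fun (f := (b.c s).comp (M.unitAct 0 1))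
    (g := (((s : K) + 1) * (α - β - s)) • b.c (s + 1)) (b.hom_ext fun r hr => ?_) x
  obtain _ | r := r
  · simp [b.act_zero_one_zero, b.c_e _ 0 hr]
  · simp only [LinearMap.comp_apply, LinearMap.smul_apply, b.act_zero_one_succ, map_smul,
      b.c_e _ (r + 1) hr, b.c_e s r (by omega), Nat.add_right_cancel_iff]
    split_ifs with h
    · rw [h]
    · simp

theorem c_zero_act_one_zero (b : WeightBasis α β l M) (x : M.carrier) :
    b.c 0 (M.unitAct 1 0 x) = 0 := by
  refine LinearMap.congr_fun (f := (b.c 0).comp (M.unitAct 1 0)) (g := 0)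
    (b.hom_ext fun r hr => ?_) x
  simp only [LinearMap.comp_apply, LinearMap.zero_apply, b.act_one_zero]
  obtain h | h := le_or_gt (r + 1) l
  · rw [b.c_e _ _ h, if_neg (by omega)]
  · rw [b.e_eq_zero _ h, map_zero]

theorem c_succ_act_one_zero (b : WeightBasis α β l M) (s : ℕ) (x : M.carrier) :
    b.c (s + 1) (M.unitAct 1 0 x) = (if s < l then 1 else 0) * b.c s x := by
  refine LinearMap.congr_fun (f := (b.c (s + 1)).comp (M.unitAct 1 0))
    (g := (if s < l then (1 : K) else 0) • b.c s) (b.hom_ext fun r hr => ?_) x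
  simp only [LinearMap.comp_apply, LinearMap.smul_apply, b.act_one_zero, b.c_e s r hr]
  obtain h | h := le_or_gt (r + 1) l
  · rw [b.c_e _ _ h]
    split_ifs <;> first | omega | simp
  · rw [b.e_eq_zero _ h, map_zero]
    split_ifs <;> first | omega | simp

theorem sum_c_smul_e (b : WeightBasis α β l M) (x : M.carrier) :
    ∑ s ∈ Finset.range (l + 1), b.c s x • b.e s = x := by
  have : ∑ s ∈ Finset.range (l + 1), (b.c s).smulRight (b.e s) = LinearMap.id := by
    refine b.hom_ext fun r hr => ?_
    simp only [LinearMap.sum_apply, LinearMap.smulRight_apply, b.c_e _ r hr, LinearMap.id_apply]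
    rw [Finset.sum_eq_single r]
    · simp
    · intro s _ hs; simp [hs]
    · intro h; simp at h; omega
  simpa using LinearMap.congr_fun this x

variable {V' : Type*} [AddCommGroup V'] [Module K V']

/-- The coordinate of a tensor at `e s ⊗ -`. -/
def coord (b : WeightBasis α β l M) (V' : Type*) [AddCommGroup V'] [Module K V'] (s : ℕ) :
    M.carrier ⊗[K] V' →ₗ[K] V' :=
  (TensorProduct.lid K V').toLinearMap.comp ((b.c s).rTensor V')

theorem coord_tmul (b : WeightBasis α β l M) (s : ℕ) (x : M.carrier) (y : V') :
    b.coord V' s (x ⊗ₜ y) = b.c s x • y := by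
  simp [coord]

theorem sum_e_tmul_coord (b : WeightBasis α β l M) (ζ : M.carrier ⊗[K] V') :
    ∑ s ∈ Finset.range (l + 1), b.e s ⊗ₜ[K] b.coord V' s ζ = ζ := by
  induction ζ using TensorProduct.induction_on with
  | zero => simp
  | add x y hx hy =>
    simp only [map_add, TensorProduct.tmul_add, Finset.sum_add_distrib, hx, hy]
  | tmul x y =>
    simp only [coord_tmul, TensorProduct.tmul_smul, TensorProduct.smul_tmul']
    rw [← TensorProduct.sum_tmul, b.sum_c_smul_e]

end WeightBasis

/-! ### The Yangian action on an evaluation module tensored with a representation -/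

section Tensor

variable {K : Type u} [Field K]

theorem AlgRep.evaluation_t_one
    (M : AlgRep K (UniversalEnvelopingAlgebra K (Matrix (Fin 2) (Fin 2) K))) (i j : Fin 2) :
    M.evaluation.ρ (Yangian.t K i j 1) = M.unitAct i j := by
  refine congrArg M.ρ (?_ : Yangian.ev (Yangian.t K i j 1) = _)
  unfold Yangian.ev
  rw [Yangian.lift_t]

theorem AlgRep.evaluation_t_add_two
    (M : AlgRep K (UniversalEnvelopingAlgebra K (Matrix (Fin 2) (Fin 2) K))) (i j : Fin 2)
    (r : ℕ) : M.evaluation.ρ (Yangian.t K i j (r + 2)) = 0 := by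
  have : Yangian.ev (Yangian.t K i j (r + 2)) = 0 := by
    unfold Yangian.ev
    rw [Yangian.lift_t]
  exact (congrArg M.ρ this).trans (map_zero _)

theorem AlgRep.tensor_t_apply (M N : AlgRep K (Yangian K (Fin 2))) (i j : Fin 2) (r : ℕ)
    (x : M.carrier) (y : N.carrier) :
    (M.tensor N).ρ (Yangian.t K i j r) (x ⊗ₜ[K] y)
      = ∑ a, ∑ z ∈ Finset.HasAntidiagonal.antidiagonal r,
        M.ρ (Yangian.t K i a z.1) x ⊗ₜ[K] N.ρ (Yangian.t K a j z.2) y := by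
  have h : (Module.endTensorEndAlgHom (R := K) (S := K) (A := K) (M := M.carrier) (N := N.carrier)
      (Algebra.TensorProduct.map M.ρ N.ρ (Yangian.comul (Yangian.t K i j r)))) (x ⊗ₜ[K] y)
      = ∑ a, ∑ z ∈ Finset.HasAntidiagonal.antidiagonal r,
        M.ρ (Yangian.t K i a z.1) x ⊗ₜ[K] N.ρ (Yangian.t K a j z.2) y := by
    rw [Yangian.comul_t]
    simp only [map_sum, Algebra.TensorProduct.map_tmul, LinearMap.sum_apply,
      Module.endTensorEndAlgHom_apply, TensorProduct.AlgebraTensorModule.map_tmul]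
  exact h

/-- The action of `t_ij^(r)` on the tensor product of an evaluation module with a representation
of the Yangian. -/
def AlgRep.evTensorT (M : AlgRep K (UniversalEnvelopingAlgebra K (Matrix (Fin 2) (Fin 2) K)))
    (N : AlgRep K (Yangian K (Fin 2))) (i j : Fin 2) (r : ℕ) :
    Module.End K (M.carrier ⊗[K] N.carrier) :=
  (M.evaluation.tensor N).ρ (Yangian.t K i j r)

theorem AlgRep.evTensorT_zero
    (M : AlgRep K (UniversalEnvelopingAlgebra K (Matrix (Fin 2) (Fin 2) K)))
    (N : AlgRep K (Yangian K (Fin 2))) (i j : Fin 2) :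
    M.evTensorT N i j 0 = if i = j then 1 else 0 := by
  have h : (M.evaluation.tensor N).ρ (Yangian.t K i j 0) = if i = j then 1 else 0 := by
    rw [(Yangian.isRTT_t K (Fin 2)).zero]
    split_ifs <;> simp
  exact h

theorem AlgRep.evTensorT_succ_apply
    (M : AlgRep K (UniversalEnvelopingAlgebra K (Matrix (Fin 2) (Fin 2) K)))
    (N : AlgRep K (Yangian K (Fin 2))) (i j : Fin 2) (r : ℕ)
    (x : M.carrier) (y : N.carrier) :
    M.evTensorT N i j (r + 1) (x ⊗ₜ[K] y)
      = x ⊗ₜ[K] N.ρ (Yangian.t K i j (r + 1)) y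
        + ∑ a, M.unitAct i a x ⊗ₜ[K] N.ρ (Yangian.t K a j r) y := by
  have key : ∀ a, ∑ z ∈ Finset.HasAntidiagonal.antidiagonal (r + 1),
      (M.evaluation.ρ (Yangian.t K i a z.1) x ⊗ₜ[K] N.ρ (Yangian.t K a j z.2) y :
        M.carrier ⊗[K] N.carrier)
      = (if i = a then x ⊗ₜ[K] N.ρ (Yangian.t K i j (r + 1)) y else 0)
        + M.unitAct i a x ⊗ₜ[K] N.ρ (Yangian.t K a j r) y := by
    intro a
    -- On an evaluation module only the coefficients of index `0` and `1` survive, so two terms of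
    -- the convolution remain.
    rw [Finset.Nat.sum_antidiagonal_eq_sum_range_succ_mk, Finset.sum_range_succ',
      Finset.sum_range_succ', Finset.sum_eq_zero, zero_add, add_comm]
    · congr 1
      · rw [(Yangian.isRTT_t K (Fin 2)).zero]
        split_ifs with h
        · subst h
          rw [map_one]; rfl
        · rw [map_zero]
          exact TensorProduct.zero_tmul _ _
      · rw [zero_add, M.evaluation_t_one]
        rfl
    · intro q _
      rw [M.evaluation_t_add_two]
      exact TensorProduct.zero_tmul _ _
  refine (AlgRep.tensor_t_apply _ _ _ _ _ _ _).trans ?_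
  refine (Finset.sum_congr rfl fun a _ => key a).trans ?_
  rw [Finset.sum_add_distrib, Finset.sum_ite_eq, if_pos (Finset.mem_univ _)]

end Tensor

/-! ### Singular vectors and functionals of tensor products -/

section Singular

variable {K : Type u} [Field K] {α β : K} {l : ℕ}
  {M : AlgRep K (UniversalEnvelopingAlgebra K (Matrix (Fin 2) (Fin 2) K))}
  (N : AlgRep K (Yangian K (Fin 2)))

/-- The form required by `IsLadder.step`: each matrix unit moves a weight coordinate to at most one
other, so a coordinate of `t_ij(u) ζ` involves only two coordinates of `ζ`. -/
theorem WeightBasis.coord_t_succ (b : WeightBasis α β l M) (i j : Fin 2) (n s : ℕ)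
    (g₀ g₁ : K) (s₀ s₁ : ℕ)
    (h₀ : ∀ x, b.c s (M.unitAct i 0 x) = g₀ * b.c s₀ x)
    (h₁ : ∀ x, b.c s (M.unitAct i 1 x) = g₁ * b.c s₁ x) (ζ : M.carrier ⊗[K] N.carrier) :
    b.coord N.carrier s (M.evTensorT N i j (n + 1) ζ)
      = N.ρ (Yangian.t K i j (n + 1)) (b.coord N.carrier s ζ)
        + g₀ • N.ρ (Yangian.t K 0 j n) (b.coord N.carrier s₀ ζ)
        + g₁ • N.ρ (Yangian.t K 1 j n) (b.coord N.carrier s₁ ζ) := by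
  refine LinearMap.congr_fun
    (f := (b.coord N.carrier s).comp (M.evTensorT N i j (n + 1)))
    (g := (N.ρ (Yangian.t K i j (n + 1))).comp (b.coord N.carrier s)
      + g₀ • (N.ρ (Yangian.t K 0 j n)).comp (b.coord N.carrier s₀)
      + g₁ • (N.ρ (Yangian.t K 1 j n)).comp (b.coord N.carrier s₁)) ?_ ζ
  refine TensorProduct.ext' fun x y => ?_
  refine (congrArg (b.coord N.carrier s) (M.evTensorT_succ_apply N i j n x y)).trans ?_
  simp only [Fin.sum_univ_two, map_add, b.coord_tmul, h₀, h₁, LinearMap.add_apply,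
    LinearMap.smul_apply, LinearMap.comp_apply, map_smul, smul_smul, add_assoc]

theorem IsLadder.tensor (b : WeightBasis α β l M)
    (hlt : ∀ m < l, ((m : K) + 1) * (α - β - m) ≠ 0) {η : N.carrier} {δs : List K}
    (H : IsLadder (fun r => N.ρ (Yangian.t K 0 1 r)) (fun r => N.ρ (Yangian.t K 1 1 r)) η δs)
    (hδ : ∀ δ ∈ δs, ∀ s < l, α - δ ≠ (s : ℕ)) :
    IsLadder (X := M.carrier ⊗[K] N.carrier)
      (fun r => M.evTensorT N 0 1 r)
      (fun r => M.evTensorT N 1 1 r) (b.e 0 ⊗ₜ η) (β :: δs) := by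
  have key := H.step (X := M.carrier ⊗[K] N.carrier)
    (a := fun r => M.evTensorT N 0 1 r)
    (d := fun r => M.evTensorT N 1 1 r) (η := b.e 0 ⊗ₜ η)
    (b.coord N.carrier) l (fun s => α - s) (fun s => β + s)
    (fun s => ((s : K) + 1) * (α - β - s)) (fun s => if s < l then 1 else 0)
    (fun ζ h => by
      rw [← b.sum_e_tmul_coord ζ]
      simp [h])
    (fun s hs => by simp [WeightBasis.coord, b.c_eq_zero s hs])
    (M.evTensorT_zero N 0 1)
    (M.evTensorT_zero N 1 1)
    (fun n s ζ => b.coord_t_succ N 0 1 n s _ _ _ _ (b.c_act_zero_zero s) (b.c_act_zero_one s) ζ)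
    (fun n ζ => by
      refine (b.coord_t_succ N 1 1 n 0 0 _ 0 _ (fun x => by rw [b.c_zero_act_one_zero, zero_mul])
        (b.c_act_one_one 0) ζ).trans ?_
      rw [zero_smul, add_zero])
    (fun n s ζ => by
      refine (b.coord_t_succ N 1 1 n (s + 1) _ _ _ _ (b.c_succ_act_one_zero s)
        (b.c_act_one_one (s + 1)) ζ).trans ?_
      exact add_right_comm _ _ _)
    (by rw [b.coord_tmul, b.c_e 0 0 (Nat.zero_le l), if_pos rfl, one_smul])
    (fun s => by rw [b.coord_tmul, b.c_e _ 0 (Nat.zero_le l), if_neg (Nat.succ_ne_zero s), zero_smul])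
    hlt
    -- A vanishing factor `-(α - s) + δ` would mean `α - δ = s`.
    (fun s hs => by
      rw [Ne, List.prod_eq_zero_iff, List.mem_map]
      rintro ⟨δ, hδm, hz⟩
      refine hδ δ hδm s hs ?_
      linear_combination -hz)
  simpa using key

/-- The functional on `N` obtained by fixing the first tensor factor as `e s`. -/
def WeightBasis.dualCoord (b : WeightBasis α β l M) (V' : Type*) [AddCommGroup V'] [Module K V']
    (s : ℕ) : Module.Dual K (M.carrier ⊗[K] V') →ₗ[K] Module.Dual K V' :=
  (TensorProduct.mk K M.carrier V' (b.e s)).dualMap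

theorem WeightBasis.dualCoord_apply (b : WeightBasis α β l M) {V' : Type*} [AddCommGroup V']
    [Module K V'] (s : ℕ) (φ : Module.Dual K (M.carrier ⊗[K] V')) (y : V') :
    b.dualCoord V' s φ y = φ (b.e s ⊗ₜ y) := rfl

theorem WeightBasis.dualCoord_t_succ (b : WeightBasis α β l M) (i j : Fin 2) (n s : ℕ)
    (g₀ g₁ : K) (s₀ s₁ : ℕ)
    (h₀ : M.unitAct i 0 (b.e s) = g₀ • b.e s₀)
    (h₁ : M.unitAct i 1 (b.e s) = g₁ • b.e s₁) (φ : Module.Dual K (M.carrier ⊗[K] N.carrier)) :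
    b.dualCoord N.carrier s
        (LinearMap.dualMap (M.evTensorT N i j (n + 1)) φ)
      = LinearMap.dualMap (N.ρ (Yangian.t K i j (n + 1))) (b.dualCoord N.carrier s φ)
        + g₀ • LinearMap.dualMap (N.ρ (Yangian.t K 0 j n)) (b.dualCoord N.carrier s₀ φ)
        + g₁ • LinearMap.dualMap (N.ρ (Yangian.t K 1 j n)) (b.dualCoord N.carrier s₁ φ) := by
  refine LinearMap.ext fun y => ?_
  refine (congrArg φ (M.evTensorT_succ_apply N i j n (b.e s) y)).trans ?_
  simp only [Fin.sum_univ_two, map_add, h₀, h₁, ← TensorProduct.smul_tmul', map_smul,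
    LinearMap.add_apply, LinearMap.smul_apply, LinearMap.dualMap_apply, b.dualCoord_apply,
    add_assoc]

theorem IsLadder.tensor_dual (b : WeightBasis α β l M) {φ : Module.Dual K N.carrier} {δs : List K}
    (H : IsLadder (fun r => LinearMap.dualMap (N.ρ (Yangian.t K 1 0 r)))
      (fun r => LinearMap.dualMap (N.ρ (Yangian.t K 0 0 r))) φ δs)
    (hδ : ∀ δ ∈ δs, ∀ s < l, δ - β ≠ (s : ℕ)) :
    IsLadder (X := Module.Dual K (M.carrier ⊗[K] N.carrier))
      (fun r => LinearMap.dualMap (M.evTensorT N 1 0 r))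
      (fun r => LinearMap.dualMap (M.evTensorT N 0 0 r))
      (φ.comp (b.coord N.carrier 0)) (α :: δs) := by
  have key := H.step (X := Module.Dual K (M.carrier ⊗[K] N.carrier))
    (a := fun r => LinearMap.dualMap (M.evTensorT N 1 0 r))
    (d := fun r => LinearMap.dualMap (M.evTensorT N 0 0 r))
    (η := φ.comp (b.coord N.carrier 0))
    (b.dualCoord N.carrier) l (fun s => β + s) (fun s => α - s)
    -- Transposition exchanges the roles of `e` and `f`: the raising coefficient now comes from `f
    -- e_s = e_{s+1}`, and the structure constants of `e` enter the diagonal series.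
    (fun _ => 1) (fun s => ((s : K) + 1) * (α - β - s))
    (fun ψ h => by
      refine LinearMap.ext fun ζ => ?_
      rw [← b.sum_e_tmul_coord ζ, map_sum]
      exact Finset.sum_eq_zero fun s _ => LinearMap.congr_fun (h s) _)
    (fun s hs => by
      refine LinearMap.ext fun ψ => LinearMap.ext fun y => ?_
      rw [b.dualCoord_apply, b.e_eq_zero s hs, TensorProduct.zero_tmul, map_zero]
      rfl)
    ((congrArg LinearMap.dualMap (M.evTensorT_zero N 1 0)).trans (by
      exact LinearMap.ext fun ψ => LinearMap.ext fun ζ => by simp))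
    (congrArg LinearMap.dualMap (M.evTensorT_zero N 0 0))
    (fun n s ψ => by
      refine (b.dualCoord_t_succ N 1 0 n s 1 _ (s + 1) _ ?_ (b.act_one_one s) ψ).trans ?_
      · rw [b.act_one_zero, one_smul]
      · exact add_right_comm _ _ _)
    (fun n ψ => by
      refine (b.dualCoord_t_succ N 0 0 n 0 _ 0 _ 0 (b.act_zero_zero 0) ?_ ψ).trans ?_
      · rw [b.act_zero_one_zero, zero_smul]
      · rw [zero_smul, add_zero])
    (fun n s ψ => b.dualCoord_t_succ N 0 0 n (s + 1) _ _ _ _ (b.act_zero_zero (s + 1))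
      (b.act_zero_one_succ s) ψ)
    (by
      refine LinearMap.ext fun y => ?_
      rw [b.dualCoord_apply, LinearMap.comp_apply, b.coord_tmul, b.c_e 0 0 (Nat.zero_le l),
        if_pos rfl, one_smul])
    (fun s => by
      refine LinearMap.ext fun y => ?_
      rw [b.dualCoord_apply, LinearMap.comp_apply, b.coord_tmul]
      obtain h | h := le_or_gt (s + 1) l
      · rw [b.c_e 0 _ h, if_neg (Nat.succ_ne_zero s).symm, zero_smul, map_zero]
        rfl
      · rw [b.e_eq_zero _ h, map_zero, zero_smul, map_zero]
        rfl)
    (fun _ _ => one_ne_zero)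
    (fun s hs => by
      rw [Ne, List.prod_eq_zero_iff, List.mem_map]
      rintro ⟨δ, hδm, hz⟩
      refine hδ δ hδm s hs ?_
      linear_combination hz)
  simpa using key

/-- The action of `t_ij^(r)` on the trivial representation. -/
def trivialT (K : Type u) [Field K] (i j : Fin 2) (r : ℕ) : Module.End K K :=
  (AlgRep.trivial K (Fin 2)).ρ (Yangian.t K i j r)

theorem trivialT_eq (K : Type u) [Field K] (i j : Fin 2) (r : ℕ) :
    trivialT K i j r = if r = 0 then (if i = j then 1 else 0) else 0 := by
  have h : Yangian.counit (Yangian.t K i j r)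
      = (if r = 0 then (if i = j then (1 : K) else 0) else 0) := by
    unfold Yangian.counit
    rw [Yangian.lift_t]
  refine LinearMap.ext fun x => (congrArg (· * x) h).trans ?_
  split_ifs <;> simp

theorem isLadder_nil {X : Type*} [AddCommGroup X] [Module K X] (a d : ℕ → Module.End K X)
    (η : X) (hη : η ≠ 0) (hX : ∀ x, ∃ c : K, x = c • η) (ha : ∀ r, a r = 0) (hd0 : d 0 = 1)
    (hd : ∀ r, d (r + 1) = 0) : IsLadder a d η [] where
  raise_zero := ha 0
  diag_zero := hd0
  raise_eq_zero r _ := ha r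
  diag_eq_zero r hr := by
    obtain _ | r := r
    · simp at hr
    · exact hd r
  ne_zero := hη
  raise_apply r := by simp [ha]
  sum_diag_apply x := by simp [hd0]
  singular ζ _ := hX ζ
  filtration := by
    refine ⟨fun n => if n = 0 then ⊥ else ⊤, if_pos rfl, ?_, ⟨1, if_neg one_ne_zero⟩, ?_, ?_⟩
    · intro m n hmn
      dsimp only
      split_ifs with h1 h2
      · exact le_rfl
      · exact bot_le
      · omega
      · exact le_rfl
    · intro r n x _
      rw [ha]
      exact Submodule.zero_mem _
    · intro r n x hx
      obtain _ | r := r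
      · rw [hd0]; exact hx
      · rw [hd]; exact Submodule.zero_mem _

theorem isLadder_trivial : IsLadder (trivialT K 0 1) (trivialT K 1 1) (1 : K) [] :=
  isLadder_nil _ _ _ one_ne_zero (fun x => ⟨x, by simp⟩) (fun r => by simp [trivialT_eq])
    (by simp [trivialT_eq]) (fun r => by simp [trivialT_eq])

theorem isLadder_trivial_dual :
    IsLadder (X := Module.Dual K K) (fun r => LinearMap.dualMap (trivialT K 1 0 r))
      (fun r => LinearMap.dualMap (trivialT K 0 0 r)) LinearMap.id [] := by
  refine isLadder_nil _ _ _ (fun h => one_ne_zero (LinearMap.congr_fun h (1 : K)))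
    (fun φ => ⟨φ 1, LinearMap.ext_ring (by simp)⟩) (fun r => ?_) ?_ fun r => ?_
  all_goals
    refine LinearMap.ext fun φ => LinearMap.ext fun x => ?_
    simp [trivialT_eq]

/-- The highest weight vectors of a tensor product of evaluation modules and of its dual. -/
theorem exists_isLadder_tensorList (l : K → K → ℕ)
    (hl : ∀ α β, ((l α β : K) + 1) * (α - β - l α β) = 0)
    (hlt : ∀ α β, ∀ m < l α β, ((m : K) + 1) * (α - β - m) ≠ 0) (ps : List (K × K))
    (hps : ps.Pairwise fun x y => ∀ s < l x.1 x.2, x.1 - y.2 ≠ (s : K) ∧ y.1 - x.2 ≠ (s : K)) :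
    ∃ (η : (AlgRep.tensorList (ps.map fun x => (irrHW x.1 x.2).evaluation)).carrier)
      (φ : Module.Dual K
        (AlgRep.tensorList (ps.map fun x => (irrHW x.1 x.2).evaluation)).carrier),
      IsLadder
        (fun r => (AlgRep.tensorList (ps.map fun x => (irrHW x.1 x.2).evaluation)).ρ
          (Yangian.t K 0 1 r))
        (fun r => (AlgRep.tensorList (ps.map fun x => (irrHW x.1 x.2).evaluation)).ρ
          (Yangian.t K 1 1 r)) η (ps.map Prod.snd) ∧
      IsLadder
        (fun r => LinearMap.dualMap
          ((AlgRep.tensorList (ps.map fun x => (irrHW x.1 x.2).evaluation)).ρ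
            (Yangian.t K 1 0 r)))
        (fun r => LinearMap.dualMap
          ((AlgRep.tensorList (ps.map fun x => (irrHW x.1 x.2).evaluation)).ρ
            (Yangian.t K 0 0 r))) φ (ps.map Prod.fst) ∧
      φ η = 1 := by
  induction ps with
  | nil =>
    exact ⟨(1 : K), (LinearMap.id : K →ₗ[K] K), isLadder_trivial, isLadder_trivial_dual, rfl⟩
  | cons x ps ih =>
    rw [List.pairwise_cons] at hps
    obtain ⟨η, φ, hη, hφ, h1⟩ := ih hps.2
    let b := irrHWBasis (hl x.1 x.2) (hlt x.1 x.2)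
    refine ⟨_, _, hη.tensor _ b (hlt x.1 x.2) ?_, hφ.tensor_dual _ b ?_, ?_⟩
    · intro δ hδ s hs
      obtain ⟨y, hy, rfl⟩ := List.mem_map.1 hδ
      exact (hps.1 y hy s hs).1
    · intro δ hδ s hs
      obtain ⟨y, hy, rfl⟩ := List.mem_map.1 hδ
      exact (hps.1 y hy s hs).2
    · refine (congrArg φ (b.coord_tmul 0 (b.e 0) η)).trans ?_
      rw [b.c_e 0 0 (Nat.zero_le _), if_pos rfl, one_smul, h1]

/-- A nonzero subrepresentation contains `η`. If it is also proper, its annihilator is nonzero and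
stable under the transposed operators, hence contains `φ`, contradicting `φ η = 1`. -/
theorem AlgRep.isIrreducible_of_isLadder (N : AlgRep K (Yangian K (Fin 2))) {η : N.carrier}
    {φ : Module.Dual K N.carrier} {δs δs' : List K}
    (H : IsLadder (fun r => N.ρ (Yangian.t K 0 1 r)) (fun r => N.ρ (Yangian.t K 1 1 r)) η δs)
    (H' : IsLadder (fun r => LinearMap.dualMap (N.ρ (Yangian.t K 1 0 r)))
      (fun r => LinearMap.dualMap (N.ρ (Yangian.t K 0 0 r))) φ δs')
    (h : φ η = 1) : N.IsIrreducible := by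
  refine ⟨⟨η, 0, H.ne_zero⟩, fun W hW => ?_⟩
  by_contra! hne
  have hηW : η ∈ W := H.mem W hne.1 fun r x hx => hW _ x hx
  have hφW : φ ∈ W.dualAnnihilator := by
    refine H'.mem _ ?_ fun r ψ hψ => ?_
    · obtain ⟨f, hf0, hf⟩ := Submodule.exists_le_ker_of_lt_top W (lt_top_iff_ne_top.2 hne.2)
      refine (Submodule.ne_bot_iff _).2 ⟨f, ?_, hf0⟩
      exact (Submodule.mem_dualAnnihilator f).2 fun w hw => hf hw
    · rw [Submodule.mem_dualAnnihilator] at hψ ⊢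
      exact fun w hw => hψ _ (hW _ w hw)
  have := (Submodule.mem_dualAnnihilator φ).1 hφW η hηW
  rw [h] at this
  exact one_ne_zero this

end Singular

/-! ### Residues modulo `p` and the ordering of the parameters -/

section Order

/-- Rows and columns of a table can be renumbered so that each diagonal entry is minimal in the
lower right block that starts at it. -/
theorem exists_perm_diag_le {k : ℕ} (w : Fin k → Fin k → ℕ) :
    ∃ σ τ : Equiv.Perm (Fin k), ∀ i j l : Fin k, i ≤ j → i ≤ l →
      w (σ i) (τ i) ≤ w (σ j) (τ l) := by
  induction k with
  | zero => exact ⟨1, 1, fun i => i.elim0⟩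
  | succ k ih =>
    obtain ⟨⟨a, b⟩, hab⟩ := Finite.exists_min fun x : Fin (k + 1) × Fin (k + 1) => w x.1 x.2
    obtain ⟨σ, τ, h⟩ := ih fun i j => w (Equiv.swap 0 a i.succ) (Equiv.swap 0 b j.succ)
    -- The position `(a, b)` of a global minimum is moved to `(0, 0)`, and the remaining rows and
    -- columns are ordered by induction: the first permutation sends `0` to `a` and `i.succ` to
    -- `swap 0 a (σ i).succ`.
    refine ⟨Equiv.Perm.decomposeFin.symm (a, σ), Equiv.Perm.decomposeFin.symm (b, τ), ?_⟩
    intro i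
    induction i using Fin.cases with
    | zero =>
      intro j l _ _
      simpa using hab (_, _)
    | succ i =>
      intro j l hj hl
      obtain ⟨j, rfl⟩ := Fin.exists_succ_eq.2 (ne_of_gt (lt_of_lt_of_le (Fin.succ_pos i) hj))
      obtain ⟨l, rfl⟩ := Fin.exists_succ_eq.2 (ne_of_gt (lt_of_lt_of_le (Fin.succ_pos i) hl))
      simpa using h i j l (Fin.succ_le_succ_iff.1 hj) (Fin.succ_le_succ_iff.1 hl)

variable (p : ℕ) [Fact p.Prime]

open scoped Classical in
/-- The highest power of `f` acting nontrivially on `L(α, β)`, as a function of `α - β`. -/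
def topDegree (x : AlgebraicClosure (ZMod p)) : ℕ :=
  if InPrimeField p x then leastResidue p x else p - 1

variable {p}

theorem inPrimeField_natCast (m : ℕ) : InPrimeField p (m : AlgebraicClosure (ZMod p)) :=
  ⟨m, map_natCast _ m⟩

theorem leastResidue_natCast_le (m : ℕ) :
    leastResidue p (m : AlgebraicClosure (ZMod p)) ≤ m :=
  Nat.sInf_le rfl

theorem exists_natCast_eq {x : AlgebraicClosure (ZMod p)} (hx : InPrimeField p x) :
    ∃ m : ℕ, m < p ∧ (m : AlgebraicClosure (ZMod p)) = x := by
  obtain ⟨y, rfl⟩ := hx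
  exact ⟨y.val, ZMod.val_lt y, by rw [← map_natCast (algebraMap (ZMod p) _), ZMod.natCast_zmod_val]⟩

theorem natCast_leastResidue {x : AlgebraicClosure (ZMod p)} (hx : InPrimeField p x) :
    (leastResidue p x : AlgebraicClosure (ZMod p)) = x := by
  obtain ⟨m, -, hm⟩ := exists_natCast_eq hx
  exact Nat.sInf_mem (s := {m : ℕ | (m : AlgebraicClosure (ZMod p)) = x}) ⟨m, hm⟩

theorem leastResidue_lt {x : AlgebraicClosure (ZMod p)} (hx : InPrimeField p x) :
    leastResidue p x < p := by
  obtain ⟨m, hmp, rfl⟩ := exists_natCast_eq hx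
  exact (leastResidue_natCast_le m).trans_lt hmp

instance charP_algebraicClosure_zmod : CharP (AlgebraicClosure (ZMod p)) p :=
  charP_of_injective_algebraMap (algebraMap (ZMod p) _).injective p

theorem topDegree_lt (x : AlgebraicClosure (ZMod p)) : topDegree p x < p := by
  unfold topDegree
  split_ifs with h
  · exact leastResidue_lt h
  · exact Nat.sub_lt (Fact.out : p.Prime).pos one_pos

/-- The second factor vanishes if `x` lies in the prime field; otherwise the first one is `p = 0`.
-/
theorem topDegree_add_one_mul (x : AlgebraicClosure (ZMod p)) :
    ((topDegree p x : AlgebraicClosure (ZMod p)) + 1) * (x - topDegree p x) = 0 := by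
  unfold topDegree
  split_ifs with h
  · rw [natCast_leastResidue h, sub_self, mul_zero]
  · rw [← Nat.cast_succ, Nat.succ_eq_add_one, Nat.sub_add_cancel (Fact.out : p.Prime).one_le,
      CharP.cast_eq_zero, zero_mul]

theorem ne_natCast_of_lt_topDegree {x : AlgebraicClosure (ZMod p)} {m : ℕ}
    (hm : m < topDegree p x) : x ≠ (m : ℕ) := by
  rintro rfl
  rw [topDegree, if_pos (inPrimeField_natCast m)] at hm
  exact absurd (leastResidue_natCast_le m) (not_le.2 hm)

theorem add_one_mul_ne_zero_of_lt_topDegree {x : AlgebraicClosure (ZMod p)} {m : ℕ}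
    (hm : m < topDegree p x) : ((m : AlgebraicClosure (ZMod p)) + 1) * (x - m) ≠ 0 := by
  refine mul_ne_zero ?_ (sub_ne_zero.2 (ne_natCast_of_lt_topDegree hm))
  rw [← Nat.cast_succ, Ne, CharP.cast_eq_zero_iff _ p]
  exact Nat.not_dvd_of_pos_of_lt (Nat.succ_pos m) (lt_of_le_of_lt hm (topDegree_lt x))

/-- If `α j - β l` were `s`, it would lie in the prime field with least residue at most `s`. This
undercuts the minimum `[α i - β i]` when that is defined, and is forbidden outright when it is not.
-/
theorem IsMinimallyOrdered.ne_natCast {k : ℕ} {α β : Fin k → AlgebraicClosure (ZMod p)}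
    (h : IsMinimallyOrdered p α β) {i j l : Fin k} (hj : i ≤ j) (hl : i ≤ l) {s : ℕ}
    (hs : s < topDegree p (α i - β i)) : α j - β l ≠ (s : ℕ) := by
  intro e
  have hin : InPrimeField p (α j - β l) := e ▸ inPrimeField_natCast s
  by_cases hi : InPrimeField p (α i - β i)
  · have h1 := (h i).1 hi j l hj hl hin
    rw [topDegree, if_pos hi] at hs
    rw [e] at h1
    exact absurd (h1.trans (leastResidue_natCast_le s)) (not_le.2 hs)
  · exact (h i).2 hi j l hj hl hin

open scoped Classical in
theorem exists_isMinimallyOrdered {k : ℕ} (α β : Fin k → AlgebraicClosure (ZMod p)) :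
    ∃ σ τ : Equiv.Perm (Fin k), IsMinimallyOrdered p (α ∘ σ) (β ∘ τ) := by
  obtain ⟨σ, τ, h⟩ := exists_perm_diag_le fun i j =>
    -- The value `p` exceeds every least residue, so an undefined entry is minimal only when all
    -- entries of its block are undefined.
    if InPrimeField p (α i - β j) then leastResidue p (α i - β j) else p
  refine ⟨σ, τ, fun i => ⟨fun hi j l hj hl hjl => ?_, fun hi j l hj hl hjl => ?_⟩⟩
  · have := h i j l hj hl
    simp only [Function.comp_apply] at hi hjl
    rwa [if_pos hi, if_pos hjl] at this
  · have := h i j l hj hl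
    simp only [Function.comp_apply] at hi hjl
    rw [if_neg hi, if_pos hjl] at this
    exact absurd (leastResidue_lt hjl) (not_lt.2 this)

end Order

/-! ### Irreducibility for minimally ordered parameters -/

theorem IsMinimallyOrdered.isIrreducible {p : ℕ} [Fact p.Prime] {k : ℕ}
    {α β : Fin k → AlgebraicClosure (ZMod p)} (h : IsMinimallyOrdered p α β) :
    (AlgRep.tensorList (List.ofFn fun i : Fin k =>
      (irrHW (α i) (β i)).evaluation)).IsIrreducible := by
  have hps : (List.ofFn fun i => (α i, β i)).Pairwise fun x y =>
      ∀ s < topDegree p (x.1 - x.2), x.1 - y.2 ≠ (s : AlgebraicClosure (ZMod p)) ∧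
        y.1 - x.2 ≠ (s : AlgebraicClosure (ZMod p)) := by
    rw [List.pairwise_ofFn]
    -- Only the row and the column of the block through its corner `(i, i)` are needed.
    exact fun i j hij s hs => ⟨h.ne_natCast le_rfl hij.le hs, h.ne_natCast hij.le le_rfl hs⟩
  obtain ⟨η, φ, hη, hφ, h1⟩ := exists_isLadder_tensorList (fun a b => topDegree p (a - b))
    (fun a b => topDegree_add_one_mul (a - b))
    (fun a b m hm => add_one_mul_ne_zero_of_lt_topDegree hm) _ hps
  have key := AlgRep.isIrreducible_of_isLadder _ hη hφ h1
  rwa [List.map_ofFn] at key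
end

theorem proposition3p2p3 (p : ℕ) [Fact p.Prime] (k : ℕ)
    (α β : Fin k → AlgebraicClosure (ZMod p)) :
    (∃ σ τ : Equiv.Perm (Fin k), IsMinimallyOrdered p (α ∘ σ) (β ∘ τ)) ∧
    ∀ σ τ : Equiv.Perm (Fin k), IsMinimallyOrdered p (α ∘ σ) (β ∘ τ) →
      (AlgRep.tensorList (List.ofFn fun i : Fin k =>
        (irrHW (α (σ i)) (β (τ i))).evaluation)).IsIrreducible :=
  ⟨exists_isMinimallyOrdered α β, fun _ _ h => h.isIrreducible⟩
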